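/- \textbf{Conventions.} Graphs are simplicial, and connected graphs are identified with their vertex sets, endowed with the path metric $d$. For a graph $X$ and an integer $n\ge 2$, the \emph{lamplighter graph} $\mathcal{L}_n(X)$ has as vertices the pairs $(c,x)$ where $c:V(X)\to\mathbb{Z}/n\mathbb{Z}$ is finitely supported and $x\in V(X)$; two vertices $(c_1,x_1),(c_2,x_2)$ are adjacent if either $c_1=c_2$ and $x_1,x_2$ are adjacent in $X$, or $x_1=x_2$ and $c_1,c_2$ differ at this vertex and nowhere else. The graph $X$ has \emph{bounded degree} if its vertex degrees are bounded by a common constant. It is \emph{coarsely $1$-connected} if it is connected and there is $R\ge 0$ such that filling in with discs all the loops of length $\le R$ in $X$ produces a simply connected $2$-complex. It is \emph{uniformly one-ended} if for every $R\ge 0$ there is $S\ge 0$ such that, for every set $A\subset V(X)$ of diameter $\le R$, the graph $X\setminus A$ has exactly one unbounded connected component and all its other components have diameter $\le S$ (diameters being measured in $X$). For a set $A$ of vertices, $\partial A$ is the set of vertices not in $A$ that are adjacent to a vertex in $A$; a graph of bounded degree is \emph{amenable} if there are non-empty finite sets of vertices $A_1,A_2,\dots$ with $|\partial A_i|/|A_i|\to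 0$. A map $f:X\to Y$ is a \emph{quasi-isometry} if there are $A>0$, $B\ge 0$ such that $\frac1A d(x,y)-B\le d(f(x),f(y))\le A\,d(x,y)+B$ for all $x,y\in X$ and every point of $Y$ is within $B$ of $f(X)$; two graphs are \emph{quasi-isometric} if there is a quasi-isometry from the first to the second. For $\kappa>0$, a map $f:X\to Y$ with finite preimages of finite sets is \emph{quasi-$\kappa$-to-one} if there is $C>0$ such that $\bigl|\kappa|A|-|f^{-1}(A)|\bigr|\le C\,|\partial A|$ for all finite sets $A\subset Y$. \textbf{Theorem.} Let $n,m\ge 2$ be two integers and let $X,Y$ be two coarsely $1$-connected, uniformly one-ended graphs of bounded degree. \begin{itemize} \item If $X$ is amenable, then $\mathcal{L}_n(X)$ and $\mathcal{L}_m(Y)$ are quasi-isometric if and only if there exist integers $k,r,s\ge 1$ such that $n=k^r$, $m=k^s$ and such that there exists a quasi-$(s/r)$-to-one quasi-isometry $X\to Y$. \item If $X$ is non-amenable, then $\mathcal{L}_n(X)$ and $\mathcal{L}_m(Y)$ are quasi-isometric if and only if $X,Y$ are quasi-isometric and $n,m$ have the same prime divisors. \end{itemize} -/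

import Mathlib

namespace LampRigid

open Filter Topology

/-! All graphs are simplicial graphs. A connected graph is identified with its vertex set, endowed
with the path metric `G.dist`. -/

/-- The lamplighter graph `L_n(X)`. Its vertices are the pairs `(c, x)` where `c` is a finitely
supported colouring of the vertices by `ℤ/nℤ` and `x` is a vertex; `(c₁, x₁)` and `(c₂, x₂)` are
adjacent if `c₁ = c₂` and `x₁, x₂` are adjacent, or if `x₁ = x₂` and `c₁, c₂` differ at this vertex
and nowhere else. -/
def lamplighter {V : Type*} (n : ℕ) (X : SimpleGraph V) : SimpleGraph ((V →₀ ZMod n) × V) where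
  Adj a b := (a.1 = b.1 ∧ X.Adj a.2 b.2) ∨
    (a.2 = b.2 ∧ a.1 a.2 ≠ b.1 a.2 ∧ ∀ z, z ≠ a.2 → a.1 z = b.1 z)
  symm := ⟨by
    rintro a b (⟨h1, h2⟩ | ⟨h1, h2, h3⟩)
    · exact Or.inl ⟨h1.symm, h2.symm⟩
    · refine Or.inr ⟨h1.symm, ?_, ?_⟩
      · rw [← h1]; exact h2.symm
      · intro z hz
        rw [← h1] at hz
        exact (h3 z hz).symm⟩
  loopless := ⟨by
    rintro a (⟨_, h⟩ | ⟨_, h, _⟩)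
    · exact X.loopless.irrefl _ h
    · exact h rfl⟩

/-- The degrees of the vertices are bounded by a common constant. -/
def BoundedDegree {V : Type*} (G : SimpleGraph V) : Prop :=
  ∃ N : ℕ, ∀ v, (G.neighborSet v).encard ≤ N

/-- Homotopy with fixed endpoints of edge paths in the 2-complex obtained from `G` by filling in
with discs the loops of length at most `R`: the congruence on walks generated by cancelling
backtracks and contracting loops of length at most `R`. -/
inductive WalkHomotopic {V : Type*} (G : SimpleGraph V) (R : ℕ) :
    ∀ {u v : V}, G.Walk u v → G.Walk u v → Prop
  | refl {u v : V} (p : G.Walk u v) : WalkHomotopic G R p p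
  | symm {u v : V} {p q : G.Walk u v} : WalkHomotopic G R p q → WalkHomotopic G R q p
  | trans {u v : V} {p q r : G.Walk u v} :
      WalkHomotopic G R p q → WalkHomotopic G R q r → WalkHomotopic G R p r
  | append {u v w : V} {p p' : G.Walk u v} {q q' : G.Walk v w} :
      WalkHomotopic G R p p' → WalkHomotopic G R q q' →
        WalkHomotopic G R (p.append q) (p'.append q')
  | backtrack {u v : V} (h : G.Adj u v) :
      WalkHomotopic G R (SimpleGraph.Walk.cons h (SimpleGraph.Walk.cons h.symm .nil)) .nil
  | fill {u : V} (c : G.Walk u u) : c.length ≤ R → WalkHomotopic G R c .nil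

/-- `G` is connected and, for some `R`, filling in the loops of length at most `R` with discs
produces a simply connected 2-complex. -/
def CoarselyOneConnected {V : Type*} (G : SimpleGraph V) : Prop :=
  G.Connected ∧ ∃ R : ℕ, ∀ (u : V) (c : G.Walk u u), WalkHomotopic G R c .nil

/-- The set of vertices `S` has diameter at most `r` in `G`. -/
def DiamLE {V : Type*} (G : SimpleGraph V) (S : Set V) (r : ℕ) : Prop :=
  ∀ x ∈ S, ∀ y ∈ S, G.dist x y ≤ r

/-- The vertices of `G` that lie in a connected component of the complement of `A`. -/
def componentVerts {V : Type*} (G : SimpleGraph V) {A : Set V}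
    (C : (G.induce Aᶜ).ConnectedComponent) : Set V :=
  Subtype.val '' C.supp

/-- For every `R` there is `S` such that the complement of every set of diameter at most `R` has
exactly one unbounded connected component, and all its other components have diameter at most
`S`. -/
def UniformlyOneEnded {V : Type*} (G : SimpleGraph V) : Prop :=
  ∀ R : ℕ, ∃ S : ℕ, ∀ A : Set V, DiamLE G A R →
    ∃ C : (G.induce Aᶜ).ConnectedComponent, (∀ r : ℕ, ¬ DiamLE G (componentVerts G C) r) ∧
      ∀ C' : (G.induce Aᶜ).ConnectedComponent, C' ≠ C → DiamLE G (componentVerts G C') S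

/-- The boundary of `A`: the vertices not in `A` that are adjacent to a vertex in `A`. -/
def boundary {V : Type*} (G : SimpleGraph V) (A : Set V) : Set V :=
  {v | v ∉ A ∧ ∃ a ∈ A, G.Adj a v}

/-- A (locally finite) graph is amenable if it admits a Følner sequence. -/
def Amenable {V : Type*} (G : SimpleGraph V) : Prop :=
  ∃ A : ℕ → Finset V, (∀ i, (A i).Nonempty) ∧
    Tendsto (fun i => ((boundary G (A i : Set V)).ncard : ℝ) / ((A i).card : ℝ)) atTop (𝓝 0)

/-- `f` is a quasi-isometry between the (connected) graphs `G` and `H`. -/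
def IsQuasiIsometry {V W : Type*} (G : SimpleGraph V) (H : SimpleGraph W) (f : V → W) : Prop :=
  ∃ A B : ℝ, 0 < A ∧ 0 ≤ B ∧
    (∀ x y, 1 / A * (G.dist x y : ℝ) - B ≤ (H.dist (f x) (f y) : ℝ) ∧
      (H.dist (f x) (f y) : ℝ) ≤ A * (G.dist x y : ℝ) + B) ∧
    ∀ z, ∃ x, (H.dist z (f x) : ℝ) ≤ B

/-- The (connected) graphs `G` and `H` are quasi-isometric. -/
def QuasiIsometric {V W : Type*} (G : SimpleGraph V) (H : SimpleGraph W) : Prop :=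
  ∃ f : V → W, IsQuasiIsometry G H f

/-- `f : V → W` is proper and quasi-`κ`-to-one with respect to the graph structure `H` on `W`. -/
def QuasiToOne {V W : Type*} (H : SimpleGraph W) (κ : ℝ) (f : V → W) : Prop :=
  (∀ A : Finset W, (f ⁻¹' (A : Set W)).Finite) ∧
    ∃ C : ℝ, 0 < C ∧ ∀ A : Finset W,
      |κ * (A.card : ℝ) - ((f ⁻¹' (A : Set W)).ncard : ℝ)| ≤
        C * ((boundary H (A : Set W)).ncard : ℝ)

end LampRigid

namespace LampRigid

open Filter Topology

/-! ### Counting along relations with bounded fibres. -/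

section Counting

/-! Call the copy of `X` in `lamplighter n X` over a fixed colouring a leaf. A coarse embedding of
`X` in `lamplighter m Y` must stay near a leaf (`exists_leaf_of_coarse_embedding`). Indeed the lamp
at `y` changes only while the arrow is near `y`; once the colours far from `y` are frozen, such
changes take place in a wall of bounded diameter and define a cochain vanishing on short loops.
Coarse simple connectivity gives it a potential, which by one-endedness is constant far from the
wall. Hence a quasi-isometry of lamplighter graphs induces a bijection `α` of colourings and a
quasi-isometry `f : X → Y` such that changing the lamp at `x` alters the image only near `f x`
(`QuasiIsometric.exists_localOver`).

Counting cosets then shows that `n ^ |A|` divides `m ^ |B|` when `B` contains a neighbourhood of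
`f(A)` (`LocalOver.pow_card_dvd`). Single vertices give the equality of prime divisors. The
valuations at `p`, used for `α` and its inverse, show that `f` is quasi-`v_p(m)/v_p(n)`-to-one.
Along Følner sets this ratio is the same for all `p`, so `n` and `m` are powers of a common integer.

Conversely, matching theorems turn a quasi-`(s/r)`-to-one quasi-isometry into a bijection `X × r ≃ Y
× s` at bounded distance (`QuasiToOne.exists_equiv`). A lamp with `k ^ r` colours is `r` lamps with
`k` colours, and moving these along the bijection yields a local `α`. Over non-amenable graphs a
quasi-isometry is quasi-`κ`-to-one for all `κ ≥ 0`, so each prime can be handled with its own ratio.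
-/

theorem encard_le_mul_of_forall_exists {α β : Type*} {S : Set α} {T : Set β}
    (R : α → β → Prop) {K : ℕ} (hS : ∀ a ∈ S, ∃ b ∈ T, R a b)
    (hR : ∀ b ∈ T, {a | R a b}.encard ≤ K) (hT : T.Finite) :
    S.Finite ∧ S.ncard ≤ K * T.ncard := by
  classical
  have hfin : ∀ b ∈ T, {a | R a b}.Finite ∧ {a | R a b}.ncard ≤ K := fun b hb =>
    Set.encard_le_coe_iff_finite_ncard_le.1 (hR b hb)
  have hsub : S ⊆ ⋃ b ∈ T, {a | R a b} := by
    intro a ha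
    obtain ⟨b, hb, hab⟩ := hS a ha
    exact Set.mem_biUnion hb hab
  have hU : (⋃ b ∈ T, {a | R a b}).Finite := hT.biUnion fun b hb => (hfin b hb).1
  refine ⟨hU.subset hsub, ?_⟩
  refine (Set.ncard_le_ncard hsub hU).trans ?_
  lift T to Finset β using hT
  choose! F hF using fun b hb => (hfin b hb).1.exists_finset_coe
  have : (⋃ b ∈ (T : Set β), {a | R a b}) = ((T.biUnion F : Finset α) : Set α) := by
    ext a
    simp only [Set.mem_iUnion, Finset.coe_biUnion]
    refine exists_congr fun b => exists_congr fun hb => ?_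
    rw [hF b hb]
  rw [this, Set.ncard_coe_finset, Set.ncard_coe_finset, mul_comm]
  refine Finset.card_biUnion_le_card_mul _ _ _ fun b hb => ?_
  rw [← Set.ncard_coe_finset, hF b hb]
  exact (hfin b hb).2

end Counting

/-! ### Balls, thickenings and boundaries. -/

section Metric

variable {V : Type*} {G : SimpleGraph V}

theorem exists_dist_le_dist_le (hc : G.Connected) {v w : V} {s t : ℕ}
    (h : G.dist v w ≤ s + t) : ∃ u, G.dist v u ≤ s ∧ G.dist u w ≤ t := by
  obtain ⟨p, hp⟩ := hc.exists_walk_length_eq_dist v w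
  refine ⟨p.getVert s, (SimpleGraph.dist_le (p.take s)).trans ?_,
    (SimpleGraph.dist_le (p.drop s)).trans ?_⟩
  · rw [SimpleGraph.Walk.take_length]; exact min_le_left _ _
  · rw [SimpleGraph.Walk.drop_length]; omega

theorem dist_le_one_iff (hc : G.Connected) {v w : V} : G.dist v w ≤ 1 ↔ v = w ∨ G.Adj v w := by
  rw [Nat.le_one_iff_eq_zero_or_eq_one, hc.dist_eq_zero_iff, SimpleGraph.dist_eq_one_iff_adj]

/-- A bound for the cardinality of the balls of each radius. -/
theorem BoundedDegree.exists_encard_ball_le (h : BoundedDegree G) (hc : G.Connected) (t : ℕ) :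
    ∃ K : ℕ, ∀ v, {w | G.dist w v ≤ t}.encard ≤ K := by
  obtain ⟨N, hN⟩ := h
  induction t with
  | zero =>
    refine ⟨1, fun v => ?_⟩
    have : {w | G.dist w v ≤ 0} = {v} := by
      ext w; simp [hc.dist_eq_zero_iff]
    rw [this]; simp
  | succ t ih =>
    obtain ⟨K, hK⟩ := ih
    refine ⟨(N + 1) * K, fun v => ?_⟩
    have hv := Set.encard_le_coe_iff_finite_ncard_le.1 (hK v)
    obtain ⟨h1, h2⟩ := encard_le_mul_of_forall_exists (S := {w | G.dist w v ≤ t + 1})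
      (T := {w | G.dist w v ≤ t}) (fun a b => G.dist a b ≤ 1) (K := N + 1) (fun a ha => by
        obtain ⟨u, hu, hu'⟩ := exists_dist_le_dist_le hc (show G.dist a v ≤ 1 + t by
          have := ha.out; omega)
        exact ⟨u, hu', hu⟩) (fun b _ => by
        have : {a | G.dist a b ≤ 1} ⊆ insert b (G.neighborSet b) := by
          intro a ha
          rcases (dist_le_one_iff hc).1 ha.out with h | h
          · exact Or.inl h
          · exact Or.inr h.symm
        refine (Set.encard_le_encard this).trans ((Set.encard_insert_le _ _).trans ?_)
        push_cast
        gcongr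
        exact hN b) hv.1
    exact Set.encard_le_coe_iff_finite_ncard_le.2
      ⟨h1, h2.trans (Nat.mul_le_mul_left _ hv.2)⟩

/-- The closed `t`-neighbourhood of `S`. -/
def thicken (G : SimpleGraph V) (S : Set V) (t : ℕ) : Set V := {v | ∃ a ∈ S, G.dist v a ≤ t}

theorem subset_thicken (S : Set V) (t : ℕ) : S ⊆ thicken G S t := fun a ha => ⟨a, ha, by simp⟩

theorem thicken_mono (S : Set V) {t t' : ℕ} (h : t ≤ t') : thicken G S t ⊆ thicken G S t' :=
  fun _ ⟨a, ha, hv⟩ => ⟨a, ha, hv.trans h⟩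

theorem thicken_zero (hc : G.Connected) (S : Set V) : thicken G S 0 = S := by
  ext v
  simp [thicken, hc.dist_eq_zero_iff]

theorem mem_thicken_add (hc : G.Connected) {S : Set V} {t r : ℕ} {v w : V}
    (hv : v ∈ thicken G S t) (h : G.dist w v ≤ r) : w ∈ thicken G S (t + r) := by
  obtain ⟨a, ha, hva⟩ := hv
  refine ⟨a, ha, ?_⟩
  have := hc.dist_triangle (u := w) (v := v) (w := a)
  omega

theorem boundary_thicken_subset (hc : G.Connected) (S : Set V) (t : ℕ) :
    boundary G (thicken G S t) ⊆ thicken G S (t + 1) \ thicken G S t := by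
  rintro v ⟨hv, a, ha, hav⟩
  exact ⟨mem_thicken_add hc ha (SimpleGraph.dist_eq_one_iff_adj.2 hav.symm).le, hv⟩

/-- The first point outside `S` on a path from `S`. -/
theorem exists_mem_boundary_dist_le (hc : G.Connected) {S : Set V} {t : ℕ} {v : V}
    (hv : v ∈ thicken G S t) (hvS : v ∉ S) : ∃ b ∈ boundary G S, G.dist v b ≤ t := by
  induction t generalizing v with
  | zero => rw [thicken_zero hc] at hv; exact absurd hv hvS
  | succ t ih =>
    obtain ⟨a, ha, hva⟩ := hv
    obtain ⟨u, hu, hu'⟩ := exists_dist_le_dist_le hc (show G.dist v a ≤ 1 + t by omega)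
    by_cases huS : u ∈ S
    · rcases (dist_le_one_iff hc).1 hu with h | h
      · exact absurd (h ▸ huS) hvS
      · exact ⟨v, ⟨hvS, u, huS, h.symm⟩, by simp⟩
    · obtain ⟨b, hb, hub⟩ := ih ⟨a, ha, hu'⟩ huS
      refine ⟨b, hb, ?_⟩
      have := hc.dist_triangle (u := v) (v := u) (w := b)
      omega

theorem boundary_subset_thicken_one (S : Set V) : boundary G S ⊆ thicken G S 1 :=
  fun _ ⟨_, a, ha, h⟩ => ⟨a, ha, (SimpleGraph.dist_eq_one_iff_adj.2 h.symm).le⟩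

theorem BoundedDegree.exists_ncard_thicken_le (h : BoundedDegree G) (hc : G.Connected) (t : ℕ) :
    ∃ K : ℕ, ∀ S : Set V, S.Finite →
      (thicken G S t).Finite ∧ (thicken G S t).ncard ≤ K * S.ncard := by
  obtain ⟨K, hK⟩ := h.exists_encard_ball_le hc t
  exact ⟨K, fun S hS => encard_le_mul_of_forall_exists (fun a b => G.dist a b ≤ t)
    (fun a ha => ha) (fun b _ => hK b) hS⟩

theorem BoundedDegree.finite_thicken (h : BoundedDegree G) (hc : G.Connected) {S : Set V}
    (hS : S.Finite) (t : ℕ) : (thicken G S t).Finite := by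
  obtain ⟨K, hK⟩ := h.exists_ncard_thicken_le hc t
  exact (hK S hS).1

theorem BoundedDegree.finite_boundary (h : BoundedDegree G) (hc : G.Connected) {S : Set V}
    (hS : S.Finite) : (boundary G S).Finite :=
  (h.finite_thicken hc hS 1).subset (boundary_subset_thicken_one S)

/-- Each added point is within `t` of the boundary of `S`; this turns thickening errors into
boundary terms. -/
theorem BoundedDegree.exists_ncard_thicken_diff_le (h : BoundedDegree G) (hc : G.Connected)
    (t : ℕ) : ∃ K : ℕ, ∀ S : Set V, S.Finite →
      (thicken G S t \ S).ncard ≤ K * (boundary G S).ncard := by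
  obtain ⟨K, hK⟩ := h.exists_encard_ball_le hc t
  exact ⟨K, fun S hS => (encard_le_mul_of_forall_exists (fun a b => G.dist a b ≤ t)
    (fun a ha => exists_mem_boundary_dist_le hc ha.1 ha.2) (fun b _ => hK b)
    (h.finite_boundary hc hS)).2⟩

end Metric

/-! ### Quasi-isometries with integer constants and quasi-inverses. -/

section Coarse

/-- `f` and `g` are coarsely Lipschitz maps that are coarsely inverse to each other. -/
structure CoarseInverse {V W : Type*} (G : SimpleGraph V) (H : SimpleGraph W) (f : V → W)
    (g : W → V) (L : ℕ) : Prop where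
  lip_left : ∀ x y, H.dist (f x) (f y) ≤ L * G.dist x y + L
  lip_right : ∀ x y, G.dist (g x) (g y) ≤ L * H.dist x y + L
  right_left : ∀ x, G.dist (g (f x)) x ≤ L
  left_right : ∀ y, H.dist (f (g y)) y ≤ L

variable {V W : Type*} {G : SimpleGraph V} {H : SimpleGraph W} {f : V → W} {g : W → V} {L : ℕ}

theorem CoarseInverse.symm (h : CoarseInverse G H f g L) : CoarseInverse H G g f L :=
  ⟨h.lip_right, h.lip_left, h.left_right, h.right_left⟩

theorem CoarseInverse.dist_le (h : CoarseInverse G H f g L) (hG : G.Connected) (x y : V) :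
    G.dist x y ≤ L * H.dist (f x) (f y) + 3 * L := by
  have h1 := h.right_left x
  have h2 := h.right_left y
  have h3 := h.lip_right (f x) (f y)
  have h4 := hG.dist_triangle (u := x) (v := g (f x)) (w := y)
  have h5 := hG.dist_triangle (u := g (f x)) (v := g (f y)) (w := y)
  rw [SimpleGraph.dist_comm] at h1
  omega

theorem CoarseInverse.isQuasiIsometry (h : CoarseInverse G H f g L) (hG : G.Connected) :
    IsQuasiIsometry G H f := by
  refine ⟨L + 1, 3 * L, by positivity, by positivity, fun x y => ⟨?_, ?_⟩, fun z => ⟨g z, ?_⟩⟩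
  · have h1 : (G.dist x y : ℝ) ≤ L * H.dist (f x) (f y) + 3 * L := by
      exact_mod_cast h.dist_le hG x y
    have h2 : (0 : ℝ) ≤ H.dist (f x) (f y) := by positivity
    have h3 : (0 : ℝ) ≤ L := by positivity
    rw [sub_le_iff_le_add, one_div, inv_mul_le_iff₀ (by positivity)]
    nlinarith
  · have h1 : (H.dist (f x) (f y) : ℝ) ≤ L * G.dist x y + L := by exact_mod_cast h.lip_left x y
    have h2 : (0 : ℝ) ≤ G.dist x y := by positivity
    have h3 : (0 : ℝ) ≤ L := by positivity
    nlinarith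
  · have h1 : (H.dist (f (g z)) z : ℝ) ≤ L := by exact_mod_cast h.left_right z
    have h3 : (0 : ℝ) ≤ L := by positivity
    rw [SimpleGraph.dist_comm]
    linarith

theorem IsQuasiIsometry.exists_coarseInverse (h : IsQuasiIsometry G H f) (hH : H.Connected) :
    ∃ g L, CoarseInverse G H f g L := by
  obtain ⟨A, B, hA, hB, hAB, hs⟩ := h
  choose g hg using hs
  -- The term `3 * A * B` serves `g`: one `A * B` for the lower bound on `f`, and one for each end
  -- `y`, at distance at most `B` from `f (g y)`.
  obtain ⟨L, hL⟩ := exists_nat_ge (A + B + A * B + 3 * A * B)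
  have hAB' : 0 ≤ A * B := by positivity
  have lower : ∀ x y, (G.dist x y : ℝ) ≤ A * H.dist (f x) (f y) + A * B := by
    intro x y
    have := (hAB x y).1
    rw [sub_le_iff_le_add, one_div, inv_mul_le_iff₀ hA] at this
    linarith
  refine ⟨g, L, fun x y => ?_, fun x y => ?_, fun x => ?_, fun y => ?_⟩
  · have h1 := (hAB x y).2
    have h2 : (0 : ℝ) ≤ G.dist x y := by positivity
    have : (H.dist (f x) (f y) : ℝ) ≤ L * G.dist x y + L := by nlinarith
    exact_mod_cast this
  · have h1 := lower (g x) (g y)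
    have h2 : (0 : ℝ) ≤ H.dist x y := by positivity
    have h3 : H.dist (f (g x)) (f (g y)) ≤ H.dist x (f (g x)) + H.dist x y + H.dist y (f (g y)) := by
      have a1 := hH.dist_triangle (u := f (g x)) (v := x) (w := f (g y))
      have a2 := hH.dist_triangle (u := x) (v := y) (w := f (g y))
      rw [SimpleGraph.dist_comm (u := f (g x)) (v := x)] at a1
      omega
    have h4 : (H.dist (f (g x)) (f (g y)) : ℝ) ≤ B + H.dist x y + B := by
      have : (H.dist (f (g x)) (f (g y)) : ℝ) ≤
        H.dist x (f (g x)) + H.dist x y + H.dist y (f (g y)) := by exact_mod_cast h3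
      linarith [hg x, hg y]
    have : (G.dist (g x) (g y) : ℝ) ≤ L * H.dist x y + L := by nlinarith
    exact_mod_cast this
  · have h1 := lower (g (f x)) x
    have h2 := hg (f x)
    rw [SimpleGraph.dist_comm] at h2
    have : (G.dist (g (f x)) x : ℝ) ≤ L := by nlinarith
    exact_mod_cast this
  · have h1 := hg y
    rw [SimpleGraph.dist_comm] at h1
    have : (H.dist (f (g y)) y : ℝ) ≤ L := by nlinarith
    exact_mod_cast this

/-- The sets of points mapped near a given point have bounded cardinality. -/
theorem CoarseInverse.exists_encard_preimage_ball_le (h : CoarseInverse G H f g L)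
    (hG : G.Connected) (hH : H.Connected) (hb : BoundedDegree G) (t : ℕ) :
    ∃ K : ℕ, ∀ y, {x | H.dist (f x) y ≤ t}.encard ≤ K := by
  obtain ⟨K, hK⟩ := hb.exists_encard_ball_le hG (L * (t + t) + 3 * L)
  refine ⟨K, fun y => ?_⟩
  rcases Set.eq_empty_or_nonempty {x | H.dist (f x) y ≤ t} with h0 | ⟨x, hx⟩
  · simp [h0]
  · refine (Set.encard_le_encard fun x' hx' => ?_).trans (hK x)
    have h1 := hH.dist_triangle (u := f x') (v := y) (w := f x)
    rw [SimpleGraph.dist_comm (u := y)] at h1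
    have := hx.out
    have := hx'.out
    exact (h.dist_le hG x' x).trans (by gcongr; omega)

theorem CoarseInverse.exists_ncard_preimage_le (h : CoarseInverse G H f g L)
    (hG : G.Connected) (hH : H.Connected) (hb : BoundedDegree G) :
    ∃ K : ℕ, ∀ S : Set W, S.Finite → (f ⁻¹' S).Finite ∧ (f ⁻¹' S).ncard ≤ K * S.ncard := by
  obtain ⟨K, hK⟩ := h.exists_encard_preimage_ball_le hG hH hb 0
  exact ⟨K, fun S hS => encard_le_mul_of_forall_exists (fun a b => H.dist (f a) b ≤ 0)
    (fun a ha => ⟨f a, ha, by simp⟩) (fun b _ => hK b) hS⟩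

end Coarse

/-! ### Distances in lamplighter graphs. -/

section LamplighterMetric

variable {V : Type*} {X : SimpleGraph V} {n : ℕ}

theorem lamplighter_adj_iff {a b : (V →₀ ZMod n) × V} :
    (lamplighter n X).Adj a b ↔ (a.1 = b.1 ∧ X.Adj a.2 b.2) ∨
      (a.2 = b.2 ∧ a.1 a.2 ≠ b.1 a.2 ∧ ∀ z, z ≠ a.2 → a.1 z = b.1 z) := Iff.rfl

/-- The inclusion of `X` in its lamplighter graph as the leaf of the colouring `c`. -/
def leafHom (X : SimpleGraph V) (c : V →₀ ZMod n) : X →g lamplighter n X where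
  toFun x := (c, x)
  map_rel' h := Or.inl ⟨rfl, h⟩

/-- The arrow has to visit every lamp whose colour changes. -/
theorem walk_lamplighter_bounds (hX : X.Connected) {a b : (V →₀ ZMod n) × V}
    (p : (lamplighter n X).Walk a b) :
    X.dist a.2 b.2 ≤ p.length ∧ ∀ z, a.1 z ≠ b.1 z → X.dist a.2 z ≤ p.length := by
  induction p with
  | nil => simp
  | @cons a a' b h p ih =>
    rw [SimpleGraph.Walk.length_cons]
    rcases lamplighter_adj_iff.1 h with ⟨h1, h2⟩ | ⟨h1, h2, h3⟩
    · have hd := SimpleGraph.dist_eq_one_iff_adj.2 h2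
      refine ⟨?_, fun z hz => ?_⟩
      · have := hX.dist_triangle (u := a.2) (v := a'.2) (w := b.2)
        omega
      · have := hX.dist_triangle (u := a.2) (v := a'.2) (w := z)
        have := ih.2 z (h1 ▸ hz)
        omega
    · rw [h1]
      refine ⟨by omega, fun z hz => ?_⟩
      by_cases hza : z = a.2
      · subst hza; simp [h1]
      · rw [h3 z hza] at hz
        have := ih.2 z hz
        omega

theorem exists_walk_lamplighter_move (hX : X.Connected) (c : V →₀ ZMod n) (x y : V) :
    ∃ p : (lamplighter n X).Walk (c, x) (c, y), p.length ≤ X.dist x y := by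
  obtain ⟨p, hp⟩ := hX.exists_walk_length_eq_dist x y
  exact ⟨p.map (leafHom X c), ((SimpleGraph.Walk.length_map _ _).trans hp).le⟩

theorem exists_walk_lamplighter_switch {c c' : V →₀ ZMod n} {x : V}
    (h : ∀ z, z ≠ x → c z = c' z) :
    ∃ p : (lamplighter n X).Walk (c, x) (c', x), p.length ≤ 1 := by
  by_cases hx : c x = c' x
  · have : c = c' := by
      ext z
      by_cases hz : z = x
      · rw [hz, hx]
      · rw [h z hz]
    subst this
    exact ⟨.nil, by simp⟩
  · have hadj : (lamplighter n X).Adj (c, x) (c', x) := Or.inr ⟨rfl, hx, h⟩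
    exact ⟨hadj.toWalk, by simp⟩

/-- Each lamp of `F` costs one round trip from `x`: at most `D` steps each way and one switch. -/
theorem exists_walk_lamplighter_le (hX : X.Connected) {x : V} {D : ℕ} (F : Finset V)
    {c c' : V →₀ ZMod n} (hF : ∀ p ∈ F, X.dist x p ≤ D) (h : ∀ p, p ∉ F → c p = c' p) :
    ∃ p : (lamplighter n X).Walk (c, x) (c', x), p.length ≤ F.card * (2 * D + 1) := by
  classical
  induction F using Finset.induction_on generalizing c with
  | empty =>
    have : c = c' := by ext z; exact h z (by simp)
    subst this
    exact ⟨.nil, by simp⟩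
  | insert q F hq ih =>
    obtain ⟨w, hw⟩ := ih (c := c.update q (c' q)) (fun p hp => hF p (Finset.mem_insert_of_mem hp))
      (fun p hp => by
        by_cases hpq : p = q
        · subst hpq; simp
        · rw [Finsupp.update_apply, if_neg hpq]
          exact h p (by simp [hpq, hp]))
    have hqD := hF q (Finset.mem_insert_self _ _)
    obtain ⟨w1, h1⟩ := exists_walk_lamplighter_move hX c x q
    obtain ⟨w2, h2⟩ := exists_walk_lamplighter_switch (X := X) (c := c) (c' := c.update q (c' q))
      (x := q) (fun z hz => by rw [Finsupp.update_apply, if_neg hz])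
    obtain ⟨w3, h3⟩ := exists_walk_lamplighter_move hX (c.update q (c' q)) q x
    refine ⟨((w1.append w2).append w3).append w, ?_⟩
    simp only [SimpleGraph.Walk.length_append]
    rw [SimpleGraph.dist_comm] at h3
    rw [Finset.card_insert_of_notMem hq, add_mul]
    omega

theorem lamplighter_connected (hX : X.Connected) : (lamplighter n X).Connected := by
  classical
  have := hX.nonempty
  refine SimpleGraph.Connected.mk fun a b => ?_
  obtain ⟨w, _⟩ := exists_walk_lamplighter_move hX a.1 a.2 b.2
  obtain ⟨w', _⟩ := exists_walk_lamplighter_le hX (x := b.2)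
    (D := (a.1.support ∪ b.1.support).sup (X.dist b.2)) (a.1.support ∪ b.1.support)
    (c := a.1) (c' := b.1) (fun p hp => Finset.le_sup hp) (fun p hp => by
      simp only [Finset.mem_union, Finsupp.mem_support_iff, not_or, not_not] at hp
      rw [hp.1, hp.2])
  exact ⟨w.append w'⟩

theorem dist_snd_le (hX : X.Connected) (a b : (V →₀ ZMod n) × V) :
    X.dist a.2 b.2 ≤ (lamplighter n X).dist a b := by
  obtain ⟨p, hp⟩ := (lamplighter_connected hX).exists_walk_length_eq_dist a b
  exact hp ▸ (walk_lamplighter_bounds hX p).1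

theorem dist_snd_le_of_ne (hX : X.Connected) {a b : (V →₀ ZMod n) × V} {z : V}
    (h : a.1 z ≠ b.1 z) : X.dist a.2 z ≤ (lamplighter n X).dist a b := by
  obtain ⟨p, hp⟩ := (lamplighter_connected hX).exists_walk_length_eq_dist a b
  exact hp ▸ (walk_lamplighter_bounds hX p).2 z h

theorem dist_snd_le_of_ne' (hX : X.Connected) {a b : (V →₀ ZMod n) × V} {z : V}
    (h : a.1 z ≠ b.1 z) : X.dist b.2 z ≤ (lamplighter n X).dist a b := by
  rw [SimpleGraph.dist_comm (u := a)]
  exact dist_snd_le_of_ne hX h.symm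

theorem dist_lamplighter_le (hX : X.Connected) {x x' : V} {D : ℕ} (F : Finset V)
    {c c' : V →₀ ZMod n} (hF : ∀ p ∈ F, X.dist x p ≤ D) (h : ∀ p, p ∉ F → c p = c' p) :
    (lamplighter n X).dist (c, x) (c', x') ≤ F.card * (2 * D + 1) + X.dist x x' := by
  obtain ⟨w, hw⟩ := exists_walk_lamplighter_le hX F hF h
  obtain ⟨w', hw'⟩ := exists_walk_lamplighter_move hX c' x x'
  refine (SimpleGraph.dist_le (w.append w')).trans ?_
  rw [SimpleGraph.Walk.length_append]
  omega

theorem dist_leaf (hX : X.Connected) (c : V →₀ ZMod n) (x y : V) :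
    (lamplighter n X).dist (c, x) (c, y) = X.dist x y := by
  refine le_antisymm ?_ (dist_snd_le hX (c, x) (c, y))
  have := dist_lamplighter_le hX (D := 0) (x := x) (x' := y) (c := c) (c' := c) (F := {})
    (by simp) (by simp)
  simpa using this

/-- The distance between points of the lamplighter graph whose colourings agree far away. -/
theorem exists_dist_lamplighter_le (hX : X.Connected) (hb : BoundedDegree X) (n D : ℕ) :
    ∃ E : ℕ, ∀ (c c' : V →₀ ZMod n) (x x' : V), (∀ p, c p ≠ c' p → X.dist x p ≤ D) →
      (lamplighter n X).dist (c, x) (c', x') ≤ E + X.dist x x' := by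
  obtain ⟨K, hK⟩ := hb.exists_encard_ball_le hX D
  refine ⟨K * (2 * D + 1), fun c c' x x' h => ?_⟩
  obtain ⟨hf, hk⟩ := Set.encard_le_coe_iff_finite_ncard_le.1 (hK x)
  obtain ⟨F, hF⟩ := hf.exists_finset_coe
  rw [← hF, Set.ncard_coe_finset] at hk
  have hmem : ∀ p, p ∈ F ↔ X.dist x p ≤ D := fun p => by
    rw [← Finset.mem_coe, hF, Set.mem_ofPred_eq, SimpleGraph.dist_comm]
  refine (dist_lamplighter_le hX (D := D) F (fun p hp => (hmem p).1 hp) (fun p hp => ?_)).trans ?_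
  · by_contra hne
    exact hp ((hmem p).2 (h p hne))
  · gcongr

theorem dist_le_one_of_forall_ne_eq {c c' : V →₀ ZMod n} {x : V}
    (h : ∀ z, z ≠ x → c z = c' z) : (lamplighter n X).dist (c, x) (c', x) ≤ 1 := by
  obtain ⟨w, hw⟩ := exists_walk_lamplighter_switch (X := X) h
  exact (SimpleGraph.dist_le w).trans hw

end LamplighterMetric

/-! ### Potentials of cochains, and functions locally constant off a bounded set. -/

section Potential

variable {V : Type*} {G : SimpleGraph V} {M : Type*} [AddCommGroup M]

/-- The sum of a `1`-cochain along a walk. -/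
def walkSum (w : V → V → M) {u v : V} (p : G.Walk u v) : M :=
  (p.darts.map fun d => w d.fst d.snd).sum

theorem walkSum_append (w : V → V → M) {u v x : V} (p : G.Walk u v) (q : G.Walk v x) :
    walkSum w (p.append q) = walkSum w p + walkSum w q := by
  simp [walkSum, SimpleGraph.Walk.darts_append]

theorem walkSum_eq_sub {w : V → V → M} {f : V → M} {u v : V} (p : G.Walk u v)
    (h : ∀ d ∈ p.darts, w d.fst d.snd = f d.snd - f d.fst) : walkSum w p = f v - f u := by
  induction p with
  | nil => simp [walkSum]
  | cons hadj p ih =>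
    have h1 := h ⟨(_, _), hadj⟩ (by simp)
    have h2 := ih fun d hd => h d (by simp [hd])
    simp only [walkSum, SimpleGraph.Walk.darts_cons, List.map_cons, List.sum_cons] at h1 h2 ⊢
    rw [h1, h2]
    abel

theorem WalkHomotopic.walkSum_eq {R : ℕ} {w : V → V → M}
    (hanti : ∀ u v, G.Adj u v → w u v + w v u = 0)
    (hloop : ∀ (u : V) (c : G.Walk u u), c.length ≤ R → walkSum w c = 0)
    {u v : V} {p q : G.Walk u v} (h : WalkHomotopic G R p q) : walkSum w p = walkSum w q := by
  induction h with
  | refl => rfl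
  | symm _ ih => exact ih.symm
  | trans _ _ ih1 ih2 => exact ih1.trans ih2
  | append _ _ ih1 ih2 => rw [walkSum_append, walkSum_append, ih1, ih2]
  | backtrack h => simpa [walkSum] using hanti _ _ h
  | fill c hc => rw [hloop _ c hc]; simp [walkSum]

/-- A cochain vanishing on short loops of a coarsely simply connected graph is a coboundary. -/
theorem exists_potential (hc : G.Connected) {R : ℕ}
    (hR : ∀ (u : V) (c : G.Walk u u), WalkHomotopic G R c .nil) {w : V → V → M}
    (hanti : ∀ u v, G.Adj u v → w u v + w v u = 0)
    (hloop : ∀ (u : V) (c : G.Walk u u), c.length ≤ R → walkSum w c = 0) :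
    ∃ h : V → M, ∀ u v, G.Adj u v → h v - h u = w u v := by
  obtain ⟨o⟩ := hc.nonempty
  have p : ∀ v, G.Walk o v := fun v => (hc.preconnected o v).some
  refine ⟨fun v => walkSum w (p v), fun u v huv => ?_⟩
  have hzero : ∀ (u : V) (c : G.Walk u u), walkSum w c = 0 := fun u c => by
    rw [(hR u c).walkSum_eq hanti hloop]; simp [walkSum]
  -- The two loops share their return path, so comparing their sums isolates `w u v`.
  have h1 := hzero o (((p u).append huv.toWalk).append (p v).reverse)
  have h2 := hzero o ((p v).append (p v).reverse)
  rw [walkSum_append] at h1 h2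
  rw [walkSum_append] at h1
  have h3 : walkSum w huv.toWalk = w u v := by
    simp [walkSum, SimpleGraph.Adj.toWalk]
  rw [h3] at h1
  rw [sub_eq_iff_eq_add]
  have h4 := h2.trans h1.symm
  rw [add_left_inj] at h4
  exact h4.trans (add_comm _ _)

/-- A point outside the component of `z₀` in the complement of `A` lies in a component adjacent
to `A`. -/
theorem exists_adj_of_component_ne {A : Set V} {z z₀ : V} (p : G.Walk z z₀) (hz : z ∉ A)
    (hz₀ : z₀ ∉ A)
    (hne : (G.induce Aᶜ).connectedComponentMk ⟨z, hz⟩ ≠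
      (G.induce Aᶜ).connectedComponentMk ⟨z₀, hz₀⟩) :
    ∃ z', ∃ a ∈ A, G.Adj z' a ∧
      z' ∈ componentVerts G ((G.induce Aᶜ).connectedComponentMk ⟨z, hz⟩) := by
  induction p with
  | nil => exact absurd rfl hne
  | @cons z z₁ z₀ h p ih =>
    by_cases h1 : z₁ ∈ A
    · exact ⟨z, z₁, h1, h, ⟨z, hz⟩, rfl, rfl⟩
    · have heq : (G.induce Aᶜ).connectedComponentMk ⟨z, hz⟩ =
          (G.induce Aᶜ).connectedComponentMk ⟨z₁, h1⟩ :=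
        SimpleGraph.ConnectedComponent.sound (SimpleGraph.Adj.reachable (by simpa using h))
      rw [heq] at hne ⊢
      exact ih h1 hz₀ hne

/-- A function that is locally constant off a bounded set takes a single value far away from
this set. -/
theorem UniformlyOneEnded.exists_eq_of_far {M : Type*} (he : UniformlyOneEnded G) (hc : G.Connected) (R : ℕ) :
    ∃ S : ℕ, ∀ (A : Set V) (h : V → M), DiamLE G A R →
      (∀ u v, G.Adj u v → u ∉ A → v ∉ A → h u = h v) →
      ∃ m : M, ∀ z, (∀ a ∈ A, S < G.dist z a) → h z = m := by
  obtain ⟨S, hS⟩ := he R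
  -- The extra `1` is the edge joining a bounded component to `A`.
  refine ⟨S + 1, fun A h hA hh => ?_⟩
  obtain ⟨C, -, hC⟩ := hS A hA
  have hconst : ∀ a b : (Aᶜ : Set V), (G.induce Aᶜ).Reachable a b → h a = h b := by
    rintro a b ⟨p⟩
    induction p with
    | nil => rfl
    | @cons a a' b hadj p ih => exact (hh _ _ (by simpa using hadj) a.2 a'.2).trans ih
  obtain ⟨z₀, rfl⟩ := C.exists_rep
  refine ⟨h z₀, fun z hz => ?_⟩
  have hzA : z ∉ A := fun h0 => by
    have := hz z h0
    simp at this
  by_cases heq : (G.induce Aᶜ).connectedComponentMk ⟨z, hzA⟩ =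
      (G.induce Aᶜ).connectedComponentMk z₀
  · exact hconst ⟨z, hzA⟩ z₀ (SimpleGraph.ConnectedComponent.exact heq)
  · obtain ⟨p⟩ := hc.preconnected z z₀
    obtain ⟨z', a, ha, hadj, hz'⟩ := exists_adj_of_component_ne p hzA z₀.2 heq
    have h1 := hC _ heq z ⟨⟨z, hzA⟩, rfl, rfl⟩ z' hz'
    have h2 := hz a ha
    have h3 := hc.dist_triangle (u := z) (v := z') (w := a)
    have h4 := SimpleGraph.dist_eq_one_iff_adj.2 hadj
    omega

end Potential

/-! ### Coarse embeddings in lamplighter graphs stay near leaves. -/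

section Embedding

variable {U W : Type*} {Z : SimpleGraph U} {Y : SimpleGraph W} {m : ℕ}

open Classical in
/-- The colouring `c` with the colours in the ball of radius `D` around `y` erased. -/
noncomputable def maskBall (Y : SimpleGraph W) (D : ℕ) (y : W) (c : W →₀ ZMod m) :
    W → ZMod m := fun p => if D < Y.dist y p then c p else 0

theorem maskBall_eq_iff {D : ℕ} {y : W} {c c' : W →₀ ZMod m} :
    maskBall Y D y c = maskBall Y D y c' ↔ ∀ p, D < Y.dist y p → c p = c' p := by
  constructor
  · intro h p hp
    have := congrFun h p
    simpa [maskBall, hp] using this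
  · intro h
    ext p
    by_cases hp : D < Y.dist y p
    · simp [maskBall, hp, h p hp]
    · simp [maskBall, hp]

open Classical in
/-- The cochain recording the changes of the lamp at `y` when the colouring far from `y`
is `χ`. -/
noncomputable def wallCochain (Y : SimpleGraph W) (D : ℕ) (ρ : U → (W →₀ ZMod m) × W) (y : W)
    (χ : W → ZMod m) (u v : U) : ZMod m :=
  if maskBall Y D y (ρ u).1 = χ then (ρ v).1 y - (ρ u).1 y else 0

theorem dist_le_length_of_mem_support (hZ : Z.Connected) {u v x y : U} (p : Z.Walk u v)
    (hx : x ∈ p.support) (hy : y ∈ p.support) : Z.dist x y ≤ 2 * p.length := by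
  classical
  have key : ∀ x ∈ p.support, Z.dist u x ≤ p.length := fun x hx =>
    (SimpleGraph.dist_le (p.takeUntil x hx)).trans (p.length_takeUntil_le_length hx)
  have h1 := key x hx
  have h2 := key y hy
  have h3 := hZ.dist_triangle (u := x) (v := u) (w := y)
  rw [SimpleGraph.dist_comm (u := x) (v := u)] at h3
  omega

section Walls

variable {A R D : ℕ} {ρ : U → (W →₀ ZMod m) × W}

theorem dist_le_of_adj_of_ne (hY : Y.Connected)
    (hρ : ∀ z z', (lamplighter m Y).dist (ρ z) (ρ z') ≤ A * Z.dist z z' + A) {u v : U}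
    (h : Z.Adj u v) {y : W} (hy : (ρ u).1 y ≠ (ρ v).1 y) : Y.dist (ρ u).2 y ≤ 2 * A := by
  have h1 := hρ u v
  rw [SimpleGraph.dist_eq_one_iff_adj.2 h] at h1
  have h2 := dist_snd_le_of_ne hY hy
  omega

/-- The image moves by at most `A * R + A`, too little to reach from near `y` a lamp at distance
more than `D` from `y`. -/
theorem maskBall_eq_of_dist_le (hY : Y.Connected)
    (hρ : ∀ z z', (lamplighter m Y).dist (ρ z) (ρ z') ≤ A * Z.dist z z' + A)
    {z z' : U} {y : W} (hz : Y.dist (ρ z).2 y ≤ 2 * A) (hzz : Z.dist z z' ≤ R)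
    (hD : 2 * A + (A * R + A) ≤ D) :
    maskBall Y D y (ρ z).1 = maskBall Y D y (ρ z').1 := by
  rw [maskBall_eq_iff]
  intro p hp
  by_contra hne
  have h1 := dist_snd_le_of_ne hY hne
  have h2 := hρ z z'
  have h3 := hY.dist_triangle (u := y) (v := (ρ z).2) (w := p)
  rw [SimpleGraph.dist_comm (u := y) (v := (ρ z).2)] at h3
  have h4 : A * Z.dist z z' ≤ A * R := Nat.mul_le_mul_left _ hzz
  omega

/-- If the lamp at `y` changes along the edge, the arrow is near `y`, so both ends have the same
mask and the two terms are opposite. -/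
theorem wallCochain_antisymm (hY : Y.Connected)
    (hρ : ∀ z z', (lamplighter m Y).dist (ρ z) (ρ z') ≤ A * Z.dist z z' + A)
    (hD : 2 * A + (A * (2 * R + 1) + A) ≤ D) (y : W) (χ : W → ZMod m) (u v : U)
    (h : Z.Adj u v) : wallCochain Y D ρ y χ u v + wallCochain Y D ρ y χ v u = 0 := by
  by_cases hy : (ρ u).1 y = (ρ v).1 y
  · simp [wallCochain, hy]
  · have h1 := dist_le_of_adj_of_ne hY hρ h hy
    have h2 := maskBall_eq_of_dist_le hY hρ h1 (R := 2 * R + 1)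
      (by rw [SimpleGraph.dist_eq_one_iff_adj.2 h]; omega) hD
    unfold wallCochain
    rw [h2]
    split_ifs <;> simp

/-- If one edge contributes, all vertices of the short loop have mask `χ`, and the cochain is along
this loop the gradient of the lamp at `y`. Otherwise every term vanishes. -/
theorem walkSum_wallCochain_eq_zero (hZ : Z.Connected) (hY : Y.Connected)
    (hρ : ∀ z z', (lamplighter m Y).dist (ρ z) (ρ z') ≤ A * Z.dist z z' + A)
    (hD : 2 * A + (A * (2 * R + 1) + A) ≤ D) (y : W) (χ : W → ZMod m) (u : U)
    (c : Z.Walk u u) (hc : c.length ≤ R) : walkSum (wallCochain Y D ρ y χ) c = 0 := by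
  by_cases h0 : ∃ d ∈ c.darts, wallCochain Y D ρ y χ d.fst d.snd ≠ 0
  · obtain ⟨d, hd, hne⟩ := h0
    have hχ : maskBall Y D y (ρ d.fst).1 = χ := by
      by_contra h; simp [wallCochain, h] at hne
    have hdy : (ρ d.fst).1 y ≠ (ρ d.snd).1 y := by
      intro h; simp [wallCochain, h] at hne
    have h1 := dist_le_of_adj_of_ne hY hρ d.adj hdy
    rw [walkSum_eq_sub (f := fun z => (ρ z).1 y) c fun e he => ?_, sub_self]
    have h2 := dist_le_length_of_mem_support hZ c (c.dart_fst_mem_support_of_mem_darts hd)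
      (c.dart_fst_mem_support_of_mem_darts he)
    have h3 := maskBall_eq_of_dist_le hY hρ h1 (R := 2 * R + 1) (h2.trans (by omega)) hD
    rw [wallCochain, if_pos (h3.symm.trans hχ)]
  · push Not at h0
    unfold walkSum
    refine List.sum_eq_zero fun x hx => ?_
    obtain ⟨d, hd, rfl⟩ := List.mem_map.1 hx
    exact h0 d hd

end Walls

/-- The value that a coarse embedding of a one-ended coarsely simply connected graph gives to the
lamp at `y` does not depend on the point, as long as it is mapped far from `y`. -/
theorem exists_forall_eq_of_far (hZ1 : CoarselyOneConnected Z) (hZe : UniformlyOneEnded Z)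
    (hY : Y.Connected) (hYb : BoundedDegree Y) (m A : ℕ) :
    ∃ D : ℕ, ∀ ρ : U → (W →₀ ZMod m) × W,
      (∀ z z', (lamplighter m Y).dist (ρ z) (ρ z') ≤ A * Z.dist z z' + A) →
      (∀ z z', Z.dist z z' ≤ A * (lamplighter m Y).dist (ρ z) (ρ z') + A) →
      ∀ z z' y, D < Y.dist (ρ z).2 y → D < Y.dist (ρ z').2 y → (ρ z).1 y = (ρ z').1 y := by
  classical
  obtain ⟨hZ, R, hR⟩ := hZ1
  -- `2 * A` bounds the distance from the arrow to a lamp changed along an edge. The rest bounds the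
  -- displacement of the image over a distance `2 * R + 1`, enough for both a short loop and a
  -- single edge.
  set D₀ := 2 * A + (A * (2 * R + 1) + A) with hD₀
  obtain ⟨E, hE⟩ := exists_dist_lamplighter_le hY hYb m (2 * A + D₀)
  obtain ⟨S, hS⟩ := hZe.exists_eq_of_far (M := ZMod m) hZ (A * (E + (2 * A + 2 * A)) + A)
  refine ⟨A * S + A + 2 * A, fun ρ hρ hρ' z z' y hz hz' => ?_⟩
  have key : ∀ χ : W → ZMod m, ∃ h : U → ZMod m,
      (∀ u v, Z.Adj u v → h v - h u = wallCochain Y D₀ ρ y χ u v) ∧ h z = h z' := by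
    intro χ
    obtain ⟨h, hh⟩ := exists_potential hZ hR (wallCochain_antisymm hY hρ le_rfl y χ)
      (walkSum_wallCochain_eq_zero hZ hY hρ le_rfl y χ)
    refine ⟨h, hh, ?_⟩
    -- This set is the wall. The images of its points differ only near `y`, so its diameter is
    -- bounded; off the wall the potential is locally constant.
    obtain ⟨a, ha⟩ := hS {z | Y.dist (ρ z).2 y ≤ 2 * A ∧ maskBall Y D₀ y (ρ z).1 = χ} h
      (by
        rintro u ⟨hu, hu'⟩ v ⟨hv, hv'⟩
        refine (hρ' u v).trans ?_
        gcongr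
        have h1 := hE (ρ u).1 (ρ v).1 (ρ u).2 (ρ v).2 (fun p hp => by
          have h2 : ¬ D₀ < Y.dist y p := fun h2 =>
            hp (maskBall_eq_iff.1 (hu'.trans hv'.symm) p h2)
          have h3 := hY.dist_triangle (u := (ρ u).2) (v := y) (w := p)
          omega)
        have h2 := hY.dist_triangle (u := (ρ u).2) (v := y) (w := (ρ v).2)
        rw [SimpleGraph.dist_comm (u := y)] at h2
        refine h1.trans ?_
        omega)
      (by
        intro u v huv hu hv
        by_contra hne
        have h1 := hh u v huv
        have h2 : wallCochain Y D₀ ρ y χ u v ≠ 0 := by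
          rw [← h1]; exact sub_ne_zero.2 (Ne.symm hne)
        have hχ : maskBall Y D₀ y (ρ u).1 = χ := by
          by_contra h; simp [wallCochain, h] at h2
        have hdy : (ρ u).1 y ≠ (ρ v).1 y := by
          intro h; simp [wallCochain, h] at h2
        exact hu ⟨dist_le_of_adj_of_ne hY hρ huv hdy, hχ⟩)
    have hfar : ∀ x, A * S + A + 2 * A < Y.dist (ρ x).2 y → h x = a := by
      intro x hx
      refine ha x fun k hk => ?_
      by_contra hle
      have h1 := hρ x k
      have h2 : A * Z.dist x k ≤ A * S := Nat.mul_le_mul_left _ (not_lt.1 hle)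
      have h3 := dist_snd_le hY (ρ x) (ρ k)
      have h4 := hY.dist_triangle (u := (ρ x).2) (v := (ρ k).2) (w := y)
      have h5 := hk.1
      omega
    rw [hfar z hz, hfar z' hz']
  choose h hadj heq using key
  -- Each edge is recorded by exactly one mask, so the potentials of the masks met along the walk
  -- add up to the variation of the lamp at `y`.
  have hwalk : ∀ (u v : U) (p : Z.Walk u v) (Q : Finset (W → ZMod m)),
      (∀ x ∈ p.support, maskBall Y D₀ y (ρ x).1 ∈ Q) →
      ∑ χ ∈ Q, (h χ v - h χ u) = (ρ v).1 y - (ρ u).1 y := by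
    intro u v p Q
    induction p with
    | nil => simp
    | @cons u u' v huv p ih =>
      intro hQ
      have h1 := ih fun x hx => hQ x (by simp [hx])
      have h2 : ∑ χ ∈ Q, (h χ u' - h χ u) = (ρ u').1 y - (ρ u).1 y := by
        rw [Finset.sum_congr rfl fun χ _ => hadj χ u u' huv]
        unfold wallCochain
        rw [Finset.sum_ite_eq, if_pos (hQ u (by simp))]
      have h3 : ∀ χ, h χ v - h χ u = (h χ v - h χ u') + (h χ u' - h χ u) := fun χ => by abel
      rw [Finset.sum_congr rfl fun χ _ => h3 χ, Finset.sum_add_distrib, h1, h2]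
      abel
  obtain ⟨p⟩ := hZ.preconnected z z'
  have := hwalk z z' p (p.support.toFinset.image fun x => maskBall Y D₀ y (ρ x).1)
    fun x hx => Finset.mem_image_of_mem _ (List.mem_toFinset.2 hx)
  rw [Finset.sum_eq_zero fun χ _ => by rw [heq χ, sub_self]] at this
  exact (sub_eq_zero.1 this.symm).symm

/-- Coarse embeddings of a one-ended coarsely simply connected graph in a lamplighter graph
are uniformly close to leaves. -/
theorem exists_leaf_of_coarse_embedding (hZ1 : CoarselyOneConnected Z)
    (hZe : UniformlyOneEnded Z) (hY : Y.Connected) (hYb : BoundedDegree Y) (m A : ℕ) :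
    ∃ D : ℕ, ∀ ρ : U → (W →₀ ZMod m) × W,
      (∀ z z', (lamplighter m Y).dist (ρ z) (ρ z') ≤ A * Z.dist z z' + A) →
      (∀ z z', Z.dist z z' ≤ A * (lamplighter m Y).dist (ρ z) (ρ z') + A) →
      ∃ c : W →₀ ZMod m, ∀ z y, D < Y.dist (ρ z).2 y → (ρ z).1 y = c y := by
  classical
  obtain ⟨D, hD⟩ := exists_forall_eq_of_far hZ1 hZe hY hYb m A
  refine ⟨D, fun ρ hρ hρ' => ?_⟩
  obtain ⟨z₀⟩ := hZ1.1.nonempty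
  let c : W → ZMod m := fun y =>
    if h : ∃ z, D < Y.dist (ρ z).2 y then (ρ h.choose).1 y else 0
  have hc : ∀ z y, D < Y.dist (ρ z).2 y → (ρ z).1 y = c y := by
    intro z y hz
    have h : ∃ z, D < Y.dist (ρ z).2 y := ⟨z, hz⟩
    simp only [c, dif_pos h]
    exact hD ρ hρ hρ' _ _ _ hz h.choose_spec
  -- Outside a finite ball around the arrow of `ρ z₀`, the function `c` is the colouring of `ρ z₀`.
  have hfin : (Function.support c).Finite := by
    refine (((ρ z₀).1.hasFiniteSupport).union
      (hYb.finite_thicken hY (Set.finite_singleton (ρ z₀).2) D)).subset fun y hy => ?_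
    by_cases hfar : D < Y.dist (ρ z₀).2 y
    · left
      rw [Function.mem_support, hc _ _ hfar]
      exact hy
    · right
      exact ⟨(ρ z₀).2, rfl, by rw [SimpleGraph.dist_comm]; omega⟩
  exact ⟨Finsupp.ofSupportFinite c hfin, hc⟩

end Embedding

theorem CoarseInverse.mono {V W : Type*} {G : SimpleGraph V} {H : SimpleGraph W} {f : V → W}
    {g : W → V} {L L' : ℕ} (h : CoarseInverse G H f g L) (hL : L ≤ L') :
    CoarseInverse G H f g L' :=
  ⟨fun x y => (h.lip_left x y).trans (by gcongr), fun x y => (h.lip_right x y).trans (by gcongr),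
    fun x => (h.right_left x).trans hL, fun y => (h.left_right y).trans hL⟩

theorem UniformlyOneEnded.exists_far {V : Type*} {G : SimpleGraph V} (he : UniformlyOneEnded G)
    (hc : G.Connected) (p : V) (N : ℕ) : ∃ x, N < G.dist x p := by
  by_contra! hle
  obtain ⟨S, hS⟩ := he 0
  obtain ⟨C, hC, -⟩ := hS ∅ (fun x hx => absurd hx (Set.notMem_empty x))
  refine hC (2 * N) fun x _ y _ => ?_
  have h1 := hc.dist_triangle (u := x) (v := p) (w := y)
  rw [SimpleGraph.dist_comm (u := p)] at h1
  have := hle x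
  have := hle y
  omega

theorem exists_agree_on_off {V M : Type*} [AddCommMonoid M] (c c' : V →₀ M) (P : V → Prop) :
    ∃ c'' : V →₀ M, (∀ p, P p → c'' p = c p) ∧ ∀ p, ¬ P p → c'' p = c' p := by
  classical
  refine ⟨c.filter P + c'.filter fun p => ¬ P p, fun p hp => ?_, fun p hp => ?_⟩ <;>
    simp [hp]

/-- A property that propagates along changes of a single lamp in `F` propagates along all
changes in `F`. -/
theorem finsupp_change_induction {V M : Type*} [Zero M] (F : Finset V)
    {Q : (V →₀ M) → Prop}
    (h : ∀ c c' p, p ∈ F → (∀ z, z ≠ p → c z = c' z) → Q c → Q c') {c c' : V →₀ M}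
    (hc : Q c) (hF : ∀ p, p ∉ F → c p = c' p) : Q c' := by
  classical
  induction F using Finset.induction_on generalizing c with
  | empty =>
    have : c = c' := by ext z; exact hF z (by simp)
    exact this ▸ hc
  | insert q F hq ih =>
    refine ih (fun c c' p hp => h c c' p (Finset.mem_insert_of_mem hp))
      (c := c.update q (c' q)) (h c _ q (Finset.mem_insert_self _ _) (fun z hz => by
        rw [Finsupp.update_apply, if_neg hz]) hc) fun p hp => ?_
    by_cases hpq : p = q
    · subst hpq; simp
    · rw [Finsupp.update_apply, if_neg hpq]
      exact hF p (by simp [hpq, hp])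

/-! ### From quasi-isometries to local bijections between colourings. -/

section Leaves

variable {V W : Type*} {X : SimpleGraph V} {Y : SimpleGraph W} {n m : ℕ}
  {q : (V →₀ ZMod n) × V → (W →₀ ZMod m) × W} {q' : (W →₀ ZMod m) × W → (V →₀ ZMod n) × V}
  {α : (V →₀ ZMod n) → (W →₀ ZMod m)} {α' : (W →₀ ZMod m) → (V →₀ ZMod n)} {L D D' : ℕ}

/-- `q` maps the leaf of each colouring `c` near the leaf of `α c`. -/
def FollowsLeaves (Y : SimpleGraph W) (q : (V →₀ ZMod n) × V → (W →₀ ZMod m) × W)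
    (α : (V →₀ ZMod n) → (W →₀ ZMod m)) (D : ℕ) : Prop :=
  ∀ c x y, D < Y.dist (q (c, x)).2 y → (q (c, x)).1 y = α c y

theorem CoarseInverse.exists_followsLeaves
    (h : CoarseInverse (lamplighter n X) (lamplighter m Y) q q' L)
    (hX1 : CoarselyOneConnected X) (hXe : UniformlyOneEnded X) (hY : Y.Connected)
    (hYb : BoundedDegree Y) : ∃ α D, FollowsLeaves Y q α D := by
  obtain ⟨D, hD⟩ := exists_leaf_of_coarse_embedding hX1 hXe hY hYb m (3 * L)
  choose α hα using fun c : V →₀ ZMod n => hD (fun x => q (c, x)) (fun x x' => by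
      have h1 := h.lip_left (c, x) (c, x')
      rw [dist_leaf hX1.1] at h1
      refine h1.trans ?_
      gcongr <;> omega) (fun x x' => by
      have h1 := h.dist_le (lamplighter_connected hX1.1) (c, x) (c, x')
      rw [dist_leaf hX1.1] at h1
      refine h1.trans ?_
      gcongr; omega)
  exact ⟨α, D, hα⟩

theorem FollowsLeaves.exists_dist_le (hα : FollowsLeaves Y q α D) (hY : Y.Connected)
    (hYb : BoundedDegree Y) :
    ∃ E : ℕ, ∀ c x, (lamplighter m Y).dist (q (c, x)) (α c, (q (c, x)).2) ≤ E := by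
  obtain ⟨E, hE⟩ := exists_dist_lamplighter_le hY hYb m D
  refine ⟨E, fun c x => ?_⟩
  have := hE (q (c, x)).1 (α c) (q (c, x)).2 (q (c, x)).2 (fun p hp => by
    by_contra hlt
    exact hp (hα c x p (not_le.1 hlt)))
  simpa using this

theorem FollowsLeaves.exists_dist_right_left_le
    (h : CoarseInverse (lamplighter n X) (lamplighter m Y) q q' L)
    (hα : FollowsLeaves Y q α D) (hX : X.Connected) (hY : Y.Connected) (hYb : BoundedDegree Y) :
    ∃ E : ℕ, ∀ c x, (lamplighter n X).dist (q' (α c, (q (c, x)).2)) (c, x) ≤ E := by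
  obtain ⟨E, hE⟩ := hα.exists_dist_le hY hYb
  refine ⟨L * E + L + L, fun c x => ?_⟩
  have h1 := h.lip_right (α c, (q (c, x)).2) (q (c, x))
  have h2 := hE c x
  rw [SimpleGraph.dist_comm] at h2
  have h3 := h.right_left (c, x)
  have h4 := (lamplighter_connected (n := n) hX).dist_triangle (u := q' (α c, (q (c, x)).2))
    (v := q' (q (c, x))) (w := (c, x))
  have h5 := Nat.mul_le_mul_left L h2
  omega

/-- Take `x` far from `p`. The projection of `q (c, x)` to the leaf of `α c` is sent back near `(c,
x)`, so the lamp at `p` of the result is both `c p` and `α' (α c) p`. -/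
theorem FollowsLeaves.leftInverse
    (h : CoarseInverse (lamplighter n X) (lamplighter m Y) q q' L)
    (hα : FollowsLeaves Y q α D) (hα' : FollowsLeaves X q' α' D') (hX : X.Connected)
    (hY : Y.Connected) (hYb : BoundedDegree Y) (hXe : UniformlyOneEnded X) :
    Function.LeftInverse α' α := by
  obtain ⟨E, hE⟩ := hα.exists_dist_right_left_le h hX hY hYb
  intro c
  ext p
  obtain ⟨x, hx⟩ := hXe.exists_far hX p (E + D')
  have h1 := hE c x
  have h2 := dist_snd_le hX (q' (α c, (q (c, x)).2)) (c, x)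
  have h3 := hX.dist_triangle (u := x) (v := (q' (α c, (q (c, x)).2)).2) (w := p)
  rw [SimpleGraph.dist_comm (u := x) (v := (q' (α c, (q (c, x)).2)).2)] at h3
  simp only at h2
  rw [← hα' (α c) (q (c, x)).2 p (by omega)]
  by_contra hne
  have h4 := dist_snd_le_of_ne' hX (b := (c, x)) hne
  simp only at h4
  omega

theorem FollowsLeaves.dist_le_of_ne
    (h : CoarseInverse (lamplighter n X) (lamplighter m Y) q q' L)
    (hα : FollowsLeaves Y q α D) (hY : Y.Connected) {c c' : V →₀ ZMod n} {x : V}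
    (hc : ∀ z, z ≠ x → c z = c' z) {y : W} (hy : α c y ≠ α c' y) :
    Y.dist (q (c, x)).2 y ≤ D + 2 * L := by
  have h1 := h.lip_left (c, x) (c', x)
  have h2 := Nat.mul_le_mul_left L (dist_le_one_of_forall_ne_eq (X := X) hc)
  by_contra hlt
  rw [← hα c x y (by omega)] at hy
  by_cases h3 : D < Y.dist (q (c', x)).2 y
  · rw [← hα c' x y h3] at hy
    have := dist_snd_le_of_ne hY hy
    omega
  · have h4 := dist_snd_le hY (q (c, x)) (q (c', x))
    have h5 := hY.dist_triangle (u := (q (c, x)).2) (v := (q (c', x)).2) (w := y)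
    omega

theorem CoarseInverse.dist_snd_le_of_forall_ne_eq
    (h : CoarseInverse (lamplighter n X) (lamplighter m Y) q q' L) (hY : Y.Connected)
    {c c' : V →₀ ZMod n} {x : V} (hc : ∀ z, z ≠ x → c z = c' z) :
    Y.dist (q (c, x)).2 (q (c', x)).2 ≤ 2 * L := by
  have h1 := h.lip_left (c, x) (c', x)
  have h2 := Nat.mul_le_mul_left L (dist_le_one_of_forall_ne_eq (X := X) hc)
  have h4 := dist_snd_le hY (q (c, x)) (q (c', x))
  omega

/-- Distinct points of a leaf that are far from each other have images whose base points are
far from each other. -/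
theorem FollowsLeaves.exists_dist_le_of_dist_le
    (h : CoarseInverse (lamplighter n X) (lamplighter m Y) q q' L)
    (hα : FollowsLeaves Y q α D) (hX : X.Connected) (hY : Y.Connected) (hYb : BoundedDegree Y)
    (T : ℕ) : ∃ N : ℕ, ∀ c x p, Y.dist (q (c, x)).2 (q (c, p)).2 ≤ T → X.dist x p ≤ N := by
  obtain ⟨E, hE⟩ := hα.exists_dist_le hY hYb
  refine ⟨L * (E + T + E) + 3 * L, fun c x p hT => ?_⟩
  have h1 := h.dist_le (lamplighter_connected hX) (c, x) (c, p)
  rw [dist_leaf hX] at h1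
  refine h1.trans ?_
  gcongr
  have hc := lamplighter_connected (n := m) hY
  have h2 := hc.dist_triangle (u := q (c, x)) (v := (α c, (q (c, x)).2)) (w := q (c, p))
  have h3 := hc.dist_triangle (u := (α c, (q (c, x)).2)) (v := (α c, (q (c, p)).2))
    (w := q (c, p))
  rw [dist_leaf hY, SimpleGraph.dist_comm (u := (α c, (q (c, p)).2))] at h3
  have h4 := hE c x
  have h5 := hE c p
  omega

/-- The base point of the image of `(c, x)` depends on `c` only up to a bounded error. -/
theorem FollowsLeaves.exists_dist_snd_le (hn : 2 ≤ n)
    (h : CoarseInverse (lamplighter n X) (lamplighter m Y) q q' L)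
    (hα : FollowsLeaves Y q α D) (hinj : Function.Injective α) (hX : X.Connected)
    (hXb : BoundedDegree X) (hY : Y.Connected) (hYb : BoundedDegree Y) :
    ∃ C : ℕ, ∀ c c' x, Y.dist (q (c, x)).2 (q (c', x)).2 ≤ C := by
  classical
  have : Fact (1 < n) := ⟨hn⟩
  set C₁ := D + 2 * L with hC₁
  obtain ⟨N, hN⟩ := hα.exists_dist_le_of_dist_le h hX hY hYb (2 * L + C₁ + C₁)
  obtain ⟨E, hE⟩ := exists_dist_lamplighter_le hX hXb n N
  -- Changes at `p` beyond `N` are invisible near the arrow over `x`. The margin `2 * L` allows for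
  -- the shift of this arrow when the lamp at `x` is toggled.
  have far : ∀ (c c' : V →₀ ZMod n) (x p : V), N < X.dist x p → (∀ z, z ≠ p → c z = c' z) →
      ∀ y, Y.dist (q (c, x)).2 y ≤ 2 * L + C₁ → α c y = α c' y := by
    intro c c' x p hp hc y hy
    by_contra hne
    have h1 := hα.dist_le_of_ne h hY hc hne
    have h2 := hY.dist_triangle (u := (q (c, x)).2) (v := y) (w := (q (c, p)).2)
    rw [SimpleGraph.dist_comm (u := y)] at h2
    have h3 := hN c x p (by omega)
    omega
  refine ⟨L * E + L + (C₁ + C₁), fun c c' x => ?_⟩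
  -- `c''` differs from `c` only near `x`, and from `c'` only far from `x`.
  obtain ⟨c'', h1, h2⟩ := exists_agree_on_off c c' (fun p => N < X.dist x p)
  have hnear : Y.dist (q (c, x)).2 (q (c'', x)).2 ≤ L * E + L := by
    have h3 := hE c c'' x x (fun p hp => by
      by_contra hlt
      exact hp (h1 p (not_le.1 hlt)).symm)
    rw [SimpleGraph.dist_self, add_zero] at h3
    have h4 := h.lip_left (c, x) (c'', x)
    have h5 := Nat.mul_le_mul_left L h3
    have h6 := dist_snd_le hY (q (c, x)) (q (c'', x))
    omega
  -- Toggling the lamp at `x` must show at some `z` near the arrow, by injectivity of `α`. Since it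
  -- still shows at `z` after changing lamps far from `x`, the point `z` is close to the arrows for
  -- both `c''` and `c'`.
  let τ : (V →₀ ZMod n) → (V →₀ ZMod n) := fun d => d + Finsupp.single x 1
  have hτ : ∀ d z, z ≠ x → d z = τ d z := fun d z hz => by
    simp [τ, Ne.symm hz]
  have hne : α c'' ≠ α (τ c'') := fun heq => by
    have h3 : c'' x = τ c'' x := by rw [← hinj heq]
    simp [τ] at h3
  obtain ⟨z, hz⟩ := Finsupp.ne_iff.1 hne
  have hz' : α c' z ≠ α (τ c') z := by
    refine finsupp_change_induction (Q := fun d => α d z ≠ α (τ d) z)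
      ((c''.support ∪ c'.support).filter fun p => N < X.dist x p) ?_ hz ?_
    · intro d d' p hp hdd hd
      have hp' := (Finset.mem_filter.1 hp).2
      have h3 := hα.dist_le_of_ne h hY (hτ d) hd
      have h4 := far d d' x p hp' hdd z (by omega)
      have h5 := h.dist_snd_le_of_forall_ne_eq hY (hτ d)
      have h6 := hY.dist_triangle (u := (q (τ d, x)).2) (v := (q (d, x)).2) (w := z)
      rw [SimpleGraph.dist_comm (u := (q (τ d, x)).2) (v := (q (d, x)).2)] at h6
      have h7 := far (τ d) (τ d') x p hp' (fun w hw => by simp [τ, hdd w hw]) z (by omega)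
      rwa [← h4, ← h7]
    · intro p hp
      by_cases hlt : N < X.dist x p
      · simp only [Finset.mem_filter, Finset.mem_union, Finsupp.mem_support_iff, hlt, and_true,
          not_or, not_not] at hp
        rw [hp.1, hp.2]
      · exact h2 p hlt
  have h3 := hα.dist_le_of_ne h hY (hτ c'') hz
  have h4 := hα.dist_le_of_ne h hY (hτ c') hz'
  have h5 := hY.dist_triangle (u := (q (c, x)).2) (v := (q (c'', x)).2) (w := (q (c', x)).2)
  have h6 := hY.dist_triangle (u := (q (c'', x)).2) (v := z) (w := (q (c', x)).2)
  rw [SimpleGraph.dist_comm (u := z)] at h6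
  omega

theorem FollowsLeaves.exists_dist_base_le
    (h : CoarseInverse (lamplighter n X) (lamplighter m Y) q q' L)
    (hα : FollowsLeaves Y q α D) (hX : X.Connected) (hY : Y.Connected) (hYb : BoundedDegree Y)
    {C : ℕ} (hC : ∀ d d' y, X.dist (q' (d, y)).2 (q' (d', y)).2 ≤ C) :
    ∃ E : ℕ, ∀ x, X.dist (q' (0, (q (0, x)).2)).2 x ≤ E := by
  obtain ⟨E, hE⟩ := hα.exists_dist_right_left_le h hX hY hYb
  refine ⟨C + E, fun x => ?_⟩
  have h1 := hC 0 (α 0) (q (0, x)).2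
  have h2 := (dist_snd_le hX _ _).trans (hE 0 x)
  have h3 := hX.dist_triangle (u := (q' (0, (q (0, x)).2)).2)
    (v := (q' (α 0, (q (0, x)).2)).2) (w := x)
  simp only at h2
  omega

/-- A bijection between colourings that is local over the map `f`: changing one lamp at `x`
changes the image only in the ball of radius `C` around `f x`. -/
def LocalOver (Y : SimpleGraph W) (α : (V →₀ ZMod n) → (W →₀ ZMod m)) (f : V → W) (C : ℕ) :
    Prop :=
  ∀ c c' x, (∀ z, z ≠ x → c z = c' z) → ∀ y, α c y ≠ α c' y → Y.dist (f x) y ≤ C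

theorem LocalOver.mono {f : V → W} {C C' : ℕ} (h : LocalOver Y α f C) (hC : C ≤ C') :
    LocalOver Y α f C' := fun c c' x hc y hy => (h c c' x hc y hy).trans hC

theorem FollowsLeaves.exists_localOver
    (h : CoarseInverse (lamplighter n X) (lamplighter m Y) q q' L)
    (hα : FollowsLeaves Y q α D) (hY : Y.Connected)
    {C : ℕ} (hC : ∀ c c' x, Y.dist (q (c, x)).2 (q (c', x)).2 ≤ C) :
    LocalOver Y α (fun x => (q (0, x)).2) (C + (D + 2 * L)) := by
  intro c c' x hc y hy
  have h1 := hα.dist_le_of_ne h hY hc hy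
  have h2 := hC 0 c x
  have h3 := hY.dist_triangle (u := (q (0, x)).2) (v := (q (c, x)).2) (w := y)
  simp only
  omega

/-- Quasi-isometries between lamplighter graphs over one-ended coarsely simply connected graphs
induce local bijections between colourings. -/
theorem QuasiIsometric.exists_localOver (hn : 2 ≤ n) (hm : 2 ≤ m)
    (hX : BoundedDegree X) (hY : BoundedDegree Y)
    (hX1 : CoarselyOneConnected X) (hY1 : CoarselyOneConnected Y)
    (hXe : UniformlyOneEnded X) (hYe : UniformlyOneEnded Y)
    (hq : QuasiIsometric (lamplighter n X) (lamplighter m Y)) :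
    ∃ (α : (V →₀ ZMod n) ≃ (W →₀ ZMod m)) (f : V → W) (g : W → V) (C : ℕ),
      CoarseInverse X Y f g C ∧ LocalOver Y α f C ∧ LocalOver X α.symm g C := by
  obtain ⟨q, hq⟩ := hq
  obtain ⟨q', L, h⟩ := hq.exists_coarseInverse (lamplighter_connected hY1.1)
  obtain ⟨α, D, hα⟩ := h.exists_followsLeaves hX1 hXe hY1.1 hY
  obtain ⟨α', D', hα'⟩ := h.symm.exists_followsLeaves hY1 hYe hX1.1 hX
  have hl := hα.leftInverse h hα' hX1.1 hY1.1 hY hXe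
  have hr := hα'.leftInverse h.symm hα hY1.1 hX1.1 hX hYe
  obtain ⟨C, hC⟩ := hα.exists_dist_snd_le hn h hl.injective hX1.1 hX hY1.1 hY
  obtain ⟨C', hC'⟩ := hα'.exists_dist_snd_le hm h.symm hr.injective hY1.1 hY hX1.1 hX
  obtain ⟨E, hE⟩ := hα.exists_dist_base_le h hX1.1 hY1.1 hY hC'
  obtain ⟨E', hE'⟩ := hα'.exists_dist_base_le h.symm hY1.1 hX1.1 hX hC
  have h1 := hα.exists_localOver h hY1.1 hC
  have h2 := hα'.exists_localOver h.symm hX1.1 hC'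
  refine ⟨⟨α, α', hl, hr⟩, fun x => (q (0, x)).2, fun y => (q' (0, y)).2,
    L + E + E' + (C + (D + 2 * L)) + (C' + (D' + 2 * L)), ⟨fun x y => ?_, fun x y => ?_,
    fun x => (hE x).trans (by omega), fun y => (hE' y).trans (by omega)⟩,
    h1.mono (by omega), h2.mono (by omega)⟩
  · refine (dist_snd_le hY1.1 _ _).trans ((h.lip_left _ _).trans ?_)
    rw [dist_leaf hX1.1]
    gcongr <;> omega
  · refine (dist_snd_le hX1.1 _ _).trans ((h.lip_right _ _).trans ?_)
    rw [dist_leaf hY1.1]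
    gcongr <;> omega

end Leaves

/-! ### Divisibility and prime valuations from local bijections. -/

theorem AddSubgroup.natCard_dvd_of_forall_add_mem {M : Type*} [AddCommGroup M] (H : AddSubgroup M)
    (T : Set M) (hT : ∀ h ∈ H, ∀ t ∈ T, h + t ∈ T) : Nat.card H ∣ Nat.card T := by
  have hpre : (QuotientAddGroup.mk ⁻¹' (QuotientAddGroup.mk '' T : Set (M ⧸ H)) : Set M) = T := by
    refine Set.Subset.antisymm ?_ (Set.subset_preimage_image _ _)
    rintro x ⟨t, ht, hx⟩
    have h1 := hT _ (QuotientAddGroup.eq.1 hx) t ht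
    rwa [add_comm (-t), neg_add_cancel_right] at h1
  have := Nat.card_congr
    (QuotientAddGroup.preimageMkEquivAddSubgroupProdSet H (QuotientAddGroup.mk '' T))
  rw [hpre, Nat.card_prod] at this
  exact this ▸ dvd_mul_right _ _

theorem natCard_supported {V : Type*} (n : ℕ) (A : Finset V) :
    Nat.card (Finsupp.supported (ZMod n) (ZMod n) (A : Set V)) = n ^ A.card := by
  rw [Nat.card_congr (Finsupp.supportedEquivFinsupp (A : Set V)).toEquiv,
    Nat.card_congr (Finsupp.equivFunOnFinite), Nat.card_fun]
  simp

section Arithmetic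

variable {V W : Type*} {X : SimpleGraph V} {Y : SimpleGraph W} {n m : ℕ}
  {α : (V →₀ ZMod n) ≃ (W →₀ ZMod m)} {f : V → W} {g : W → V} {C : ℕ}

theorem LocalOver.eq_of_notMem_thicken (h : LocalOver Y α f C) (A : Finset V)
    {c c' : V →₀ ZMod n} (hc : ∀ p, p ∉ A → c p = c' p) {y : W}
    (hy : y ∉ thicken Y (f '' A) C) : α c y = α c' y := by
  refine finsupp_change_induction (Q := fun d => α c y = α d y) A ?_ rfl hc
  intro d d' p hp hd hcd
  rw [hcd]
  by_contra hne
  exact hy ⟨f p, ⟨p, hp, rfl⟩, by rw [SimpleGraph.dist_comm]; exact h d d' p hd y hne⟩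

/-- There are `m ^ B.card` colourings with image supported in `B`, as `α` is bijective. Adding a
colouring supported in `A` alters the image only inside `B`, so they form a union of cosets of a
group of order `n ^ A.card`. -/
theorem LocalOver.pow_card_dvd (h : LocalOver Y α f C) (A : Finset V) (B : Finset W)
    (hAB : thicken Y (f '' A) C ⊆ B) : n ^ A.card ∣ m ^ B.card := by
  rw [← natCard_supported n A, ← natCard_supported m B]
  have hcard : Nat.card {c | α c ∈ Finsupp.supported (ZMod m) (ZMod m) (B : Set W)} =
      Nat.card (Finsupp.supported (ZMod m) (ZMod m) (B : Set W)) :=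
    Nat.card_congr (α.subtypeEquiv fun c => Iff.rfl)
  rw [← hcard]
  refine AddSubgroup.natCard_dvd_of_forall_add_mem
    (Finsupp.supported (ZMod n) (ZMod n) (A : Set V)).toAddSubgroup _ fun d hd t ht => ?_
  change α (d + t) ∈ Finsupp.supported (ZMod m) (ZMod m) (B : Set W)
  replace ht : α t ∈ Finsupp.supported (ZMod m) (ZMod m) (B : Set W) := ht
  replace hd : d ∈ Finsupp.supported (ZMod n) (ZMod n) (A : Set V) := hd
  rw [Finsupp.mem_supported'] at hd ht ⊢
  intro y hy
  rw [← ht y hy]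
  refine h.eq_of_notMem_thicken A (fun p hp => ?_) fun hy' => hy (hAB hy')
  simp [hd p hp]

theorem LocalOver.dvd_of_prime_dvd (h : LocalOver Y α f C) (hX : X.Connected) (hY : Y.Connected)
    (hYb : BoundedDegree Y) {p : ℕ} (hp : p.Prime) (hpn : p ∣ n) : p ∣ m := by
  obtain ⟨v⟩ := hX.nonempty
  obtain ⟨B, hB⟩ := (hYb.finite_thicken hY
    ((Set.finite_singleton v).image f) C).exists_finset_coe
  have h1 := h.pow_card_dvd {v} B (by rw [hB]; simp)
  rw [Finset.card_singleton, pow_one] at h1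
  exact hp.dvd_of_dvd_pow (hpn.trans h1)

theorem LocalOver.factorization_mul_card_le (h : LocalOver Y α f C) (hn : n ≠ 0) (hm : m ≠ 0)
    {A : Set V} {B : Set W} (hA : A.Finite) (hB : B.Finite)
    (hAB : thicken Y (f '' A) C ⊆ B) (p : ℕ) :
    n.factorization p * A.ncard ≤ m.factorization p * B.ncard := by
  lift A to Finset V using hA
  lift B to Finset W using hB
  have h1 := (Nat.factorization_le_iff_dvd (pow_ne_zero _ hn) (pow_ne_zero _ hm)).2
    (h.pow_card_dvd A B hAB) p
  simp only [Nat.factorization_pow, Finsupp.smul_apply, smul_eq_mul] at h1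
  rw [Set.ncard_coe_finset, Set.ncard_coe_finset, mul_comm, mul_comm (m.factorization p)]
  exact h1

theorem CoarseInverse.thicken_image_subset (h : CoarseInverse X Y f g C) (hY : Y.Connected)
    (B : Set W) : thicken X (g '' B) C ⊆ f ⁻¹' thicken Y B (C * C + C + C) := by
  rintro x ⟨_, ⟨b, hb, rfl⟩, hx⟩
  refine ⟨b, hb, ?_⟩
  have h1 := h.lip_left x (g b)
  have h2 := h.left_right b
  have h3 := hY.dist_triangle (u := f x) (v := f (g b)) (w := b)
  have h4 := Nat.mul_le_mul_left C hx
  omega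

theorem CoarseInverse.thicken_image_thicken_image_subset (h : CoarseInverse X Y f g C)
    (hX : X.Connected) (A : Set V) :
    thicken X (g '' thicken Y (f '' A) C) C ⊆ thicken X A (C + (C * C + C) + C) := by
  rintro x ⟨_, ⟨b, ⟨_, ⟨a, ha, rfl⟩, hb⟩, rfl⟩, hx⟩
  refine ⟨a, ha, ?_⟩
  have h1 := h.lip_right b (f a)
  have h2 := h.right_left a
  have h3 := hX.dist_triangle (u := x) (v := g b) (w := a)
  have h4 := hX.dist_triangle (u := g b) (v := g (f a)) (w := a)
  have h5 := Nat.mul_le_mul_left C hb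
  omega

/-- Locality of `α` bounds the preimage of `A` by a thickening of `A`; locality of `α.symm` bounds
`A` by the preimage of a thickening. Both errors live near the boundary. -/
theorem LocalOver.quasiToOne (hα : LocalOver Y α f C) (hα' : LocalOver X α.symm g C)
    (h : CoarseInverse X Y f g C) (hn : n ≠ 0) (hm : m ≠ 0) (hX : X.Connected)
    (hY : Y.Connected) (hXb : BoundedDegree X) (hYb : BoundedDegree Y) {p : ℕ}
    (hp : n.factorization p ≠ 0) :
    QuasiToOne Y ((m.factorization p : ℝ) / n.factorization p) f := by
  obtain ⟨K, hK⟩ := h.exists_ncard_preimage_le hX hY hXb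
  refine ⟨fun A => (hK _ A.finite_toSet).1, ?_⟩
  obtain ⟨K₁, hK₁⟩ := hYb.exists_ncard_thicken_diff_le hY C
  obtain ⟨K₂, hK₂⟩ := hYb.exists_ncard_thicken_diff_le hY (C * C + C + C)
  set v := n.factorization p
  set w := m.factorization p
  refine ⟨(w * K₁ + v * (K * K₂)) / v + 1, by positivity, fun A => ?_⟩
  have hA := A.finite_toSet
  set b := (boundary Y (A : Set W)).ncard
  have hfP := (hK _ hA).1
  have hT₁ := hYb.finite_thicken hY hA C
  have hT₂ := hYb.finite_thicken hY hA (C * C + C + C)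
  have upper : v * (f ⁻¹' (A : Set W)).ncard ≤ w * (A.card + K₁ * b) := by
    have h1 := hα.factorization_mul_card_le hn hm hfP hT₁ (by
      rintro y ⟨a, ⟨x, hx, rfl⟩, hy⟩
      exact ⟨f x, hx, hy⟩) p
    refine h1.trans (Nat.mul_le_mul_left _ ?_)
    have h2 := Set.ncard_sdiff_add_ncard_of_subset (subset_thicken (G := Y) (A : Set W) C) hT₁
    rw [Set.ncard_coe_finset] at h2
    have h3 : _ ≤ K₁ * b := hK₁ _ hA
    omega
  have lower : w * A.card ≤ v * ((f ⁻¹' (A : Set W)).ncard + K * (K₂ * b)) := by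
    have h1 := hα'.factorization_mul_card_le hm hn hA (hK _ hT₂).1
      (h.thicken_image_subset hY _) p
    rw [Set.ncard_coe_finset] at h1
    refine h1.trans (Nat.mul_le_mul_left _ ?_)
    have hfin : (thicken Y (A : Set W) (C * C + C + C) \ A).Finite := hT₂.subset Set.sdiff_subset
    have h2 : f ⁻¹' thicken Y (A : Set W) (C * C + C + C) ⊆
        f ⁻¹' (A : Set W) ∪ f ⁻¹' (thicken Y (A : Set W) (C * C + C + C) \ A) := by
      intro x hx
      by_cases hxA : f x ∈ A
      · exact Or.inl hxA
      · exact Or.inr ⟨hx, hxA⟩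
    refine (Set.ncard_le_ncard h2 (hfP.union (hK _ hfin).1)).trans
      ((Set.ncard_union_le _ _).trans ?_)
    gcongr
    exact (hK _ hfin).2.trans (Nat.mul_le_mul_left _ (hK₂ _ hA))
  have hv : (0 : ℝ) < v := by positivity
  have upper' : (v : ℝ) * (f ⁻¹' (A : Set W)).ncard ≤ w * (A.card + K₁ * b) := by
    exact_mod_cast upper
  have lower' : (w : ℝ) * A.card ≤ v * ((f ⁻¹' (A : Set W)).ncard + K * (K₂ * b)) := by
    exact_mod_cast lower
  have hb : (0 : ℝ) ≤ b := by positivity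
  have e1 : (0 : ℝ) ≤ w * K₁ * b := by positivity
  have e2 : (0 : ℝ) ≤ v * (K * K₂) * b := by positivity
  have e3 : (0 : ℝ) ≤ v * b := by positivity
  have key : |(w : ℝ) * A.card - v * (f ⁻¹' (A : Set W)).ncard| ≤
      (w * K₁ + v * (K * K₂) + v) * b := by
    rw [abs_le]
    constructor <;> nlinarith
  have e4 : (w : ℝ) / v * A.card - (f ⁻¹' (A : Set W)).ncard =
      ((w : ℝ) * A.card - v * (f ⁻¹' (A : Set W)).ncard) / v := by
    field_simp
  rw [e4, abs_div, abs_of_pos hv, div_le_iff₀ hv]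
  refine key.trans (le_of_eq ?_)
  field_simp

/-- Over an amenable graph, the ratios of the multiplicities of the primes do not depend on
the prime. -/
theorem LocalOver.factorization_mul_comm (hα : LocalOver Y α f C) (hα' : LocalOver X α.symm g C)
    (h : CoarseInverse X Y f g C) (hn : n ≠ 0) (hm : m ≠ 0) (hX : X.Connected)
    (hY : Y.Connected) (hXb : BoundedDegree X) (hYb : BoundedDegree Y) (ham : Amenable X)
    (p p' : ℕ) :
    m.factorization p * n.factorization p' = n.factorization p * m.factorization p' := by
  obtain ⟨A, hA, hlim⟩ := ham
  obtain ⟨K, hK⟩ := hXb.exists_ncard_thicken_diff_le hX (C + (C * C + C) + C)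
  let B : ℕ → Set W := fun i => thicken Y (f '' A i) C
  have hBf : ∀ i, (B i).Finite := fun i => hYb.finite_thicken hY ((A i).finite_toSet.image f) C
  -- The two localities squeeze this sequence. The ratio of cardinalities does not involve `p`, so
  -- cross-multiplying the limits for `p` and `p'` proves the claim.
  have hlim' : ∀ p, Tendsto (fun i => (m.factorization p : ℝ) * ((B i).ncard / (A i).card))
      atTop (𝓝 (n.factorization p)) := by
    intro p
    have hup : Tendsto (fun i => (n.factorization p : ℝ) *
        (1 + K * ((boundary X (A i : Set V)).ncard / ((A i).card : ℝ)))) atTop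
        (𝓝 (n.factorization p)) := by
      have := ((hlim.const_mul (K : ℝ)).const_add 1).const_mul (n.factorization p : ℝ)
      simpa using this
    refine tendsto_of_tendsto_of_tendsto_of_le_of_le tendsto_const_nhds hup (fun i => ?_)
      (fun i => ?_)
    · have hpos : (0 : ℝ) < (A i).card := by exact_mod_cast (hA i).card_pos
      have h1 := hα.factorization_mul_card_le hn hm (A i).finite_toSet (hBf i) subset_rfl p
      rw [Set.ncard_coe_finset] at h1
      simp only
      rw [← mul_div_assoc, le_div_iff₀ hpos]
      exact_mod_cast h1
    · have hpos : (0 : ℝ) < (A i).card := by exact_mod_cast (hA i).card_pos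
      have hfT := hXb.finite_thicken hX (A i).finite_toSet (C + (C * C + C) + C)
      have h1 := hα'.factorization_mul_card_le hm hn (hBf i) hfT
        (h.thicken_image_thicken_image_subset hX _) p
      have h2 := Set.ncard_sdiff_add_ncard_of_subset
        (subset_thicken (G := X) (A i : Set V) (C + (C * C + C) + C)) hfT
      rw [Set.ncard_coe_finset] at h2
      have h3 := hK _ (A i).finite_toSet
      have h4 : m.factorization p * (B i).ncard ≤ n.factorization p *
          ((A i).card + K * (boundary X (A i : Set V)).ncard) :=
        h1.trans (Nat.mul_le_mul_left _ (by omega))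
      have h5 : (m.factorization p : ℝ) * (B i).ncard ≤ n.factorization p *
          ((A i).card + K * (boundary X (A i : Set V)).ncard) := by exact_mod_cast h4
      simp only
      rw [← mul_div_assoc, div_le_iff₀ hpos]
      refine h5.trans (le_of_eq ?_)
      field_simp
  have h1 := (hlim' p).const_mul (m.factorization p' : ℝ)
  have h2 := (hlim' p').const_mul (m.factorization p : ℝ)
  have h3 := tendsto_nhds_unique (h1.congr fun i => by ring) h2
  have h4 : m.factorization p' * n.factorization p = m.factorization p * n.factorization p' := by
    exact_mod_cast h3
  rw [← h4, mul_comm]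

end Arithmetic

/-- Integers whose prime multiplicities are proportional are powers of a common integer. -/
theorem exists_eq_pow_of_factorization_mul_comm {n m : ℕ} (hn : 2 ≤ n) (hm : 2 ≤ m)
    (hp : ∀ p p', m.factorization p * n.factorization p' =
      n.factorization p * m.factorization p') :
    ∃ p k r s : ℕ, 1 ≤ k ∧ 1 ≤ r ∧ 1 ≤ s ∧ n = k ^ r ∧ m = k ^ s ∧ n.factorization p ≠ 0 ∧
      (m.factorization p : ℝ) / n.factorization p = s / r := by
  set p := n.minFac
  have hpp : p.Prime := Nat.minFac_prime (by omega)
  have hv : n.factorization p ≠ 0 :=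
    (hpp.factorization_pos_of_dvd (by omega) (Nat.minFac_dvd n)).ne'
  have hw : m.factorization p ≠ 0 := by
    intro h0
    have hz : ∀ q, m.factorization q = 0 := fun q => by
      have := hp p q
      rw [h0, zero_mul] at this
      exact (mul_eq_zero.1 this.symm).resolve_left hv
    have h2 := (Nat.minFac_prime (n := m) (by omega)).factorization_pos_of_dvd (by omega)
      (Nat.minFac_dvd m)
    exact h2.ne' (hz _)
  have hpow : n ^ m.factorization p = m ^ n.factorization p := by
    refine Nat.eq_of_factorization_eq (pow_ne_zero _ (by omega)) (pow_ne_zero _ (by omega))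
      fun q => ?_
    simpa using hp p q
  obtain ⟨k, hk₁, hk₂⟩ := Nat.exists_eq_pow_of_pow_eq_pow (Or.inl hw) hpow
  set v := n.factorization p
  set w := m.factorization p
  have hg : 0 < Nat.gcd w v := Nat.gcd_pos_of_pos_left _ (Nat.pos_of_ne_zero hw)
  have hr : 1 ≤ v / Nat.gcd w v :=
    Nat.div_pos (Nat.gcd_le_right _ (Nat.pos_of_ne_zero hv)) hg
  have hs : 1 ≤ w / Nat.gcd w v :=
    Nat.div_pos (Nat.gcd_le_left _ (Nat.pos_of_ne_zero hw)) hg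
  refine ⟨p, k, _, _, ?_, hr, hs, hk₁, hk₂, hv, ?_⟩
  · rcases Nat.eq_zero_or_pos k with h0 | h0
    · rw [h0, zero_pow (by omega)] at hk₁
      omega
    · exact h0
  · have hg' : ((Nat.gcd w v : ℕ) : ℝ) ≠ 0 := by exact_mod_cast hg.ne'
    rw [Nat.cast_div (Nat.gcd_dvd_left _ _) hg', Nat.cast_div (Nat.gcd_dvd_right _ _) hg',
      div_div_div_cancel_right₀ hg']

/-! ### Matchings with multiplicities. -/

section Matching

variable {P Q : Type*}

/-- Hall's theorem for `a` copies of each `p` and `b` copies of each `q`: a set of copies is at most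
as large as the full fibres over its projection. -/
theorem exists_injective_of_rel (R : P → Q → Prop) (a b : ℕ) (hfin : ∀ p, {q | R p q}.Finite)
    (h : ∀ A : Finset P, a * A.card ≤ b * {q | ∃ p ∈ A, R p q}.ncard) :
    ∃ F : P × Fin a → Q × Fin b, Function.Injective F ∧ ∀ x, R x.1 (F x).1 := by
  classical
  choose t ht using fun p => (hfin p).exists_finset_coe
  have hmem : ∀ p q, q ∈ t p ↔ R p q := fun p q => by
    rw [← Finset.mem_coe, ht]; rfl
  obtain ⟨F, hF, hF'⟩ := (Finset.all_card_le_biUnion_card_iff_exists_injective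
    (fun x : P × Fin a => t x.1 ×ˢ (Finset.univ : Finset (Fin b)))).1 fun s => by
      have h1 : s ⊆ s.image Prod.fst ×ˢ (Finset.univ : Finset (Fin a)) := fun x hx =>
        Finset.mem_product.2 ⟨Finset.mem_image_of_mem _ hx, Finset.mem_univ _⟩
      have h2 : s.biUnion (fun x : P × Fin a => t x.1 ×ˢ (Finset.univ : Finset (Fin b))) =
          (s.image Prod.fst).biUnion t ×ˢ Finset.univ := by
        ext y
        simp only [Finset.mem_biUnion, Finset.mem_product, Finset.mem_univ, and_true,
          Finset.mem_image]
        constructor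
        · rintro ⟨x, hx, hy⟩
          exact ⟨x.1, ⟨x, hx, rfl⟩, hy⟩
        · rintro ⟨_, ⟨x, hx, rfl⟩, hy⟩
          exact ⟨x, hx, hy⟩
      have h3 : {q | ∃ p ∈ s.image Prod.fst, R p q} =
          (((s.image Prod.fst).biUnion t : Finset Q) : Set Q) := by
        ext q
        simp only [Set.mem_ofPred_eq, Finset.mem_coe, Finset.mem_biUnion, hmem]
      have h4 := h (s.image Prod.fst)
      rw [h3, Set.ncard_coe_finset] at h4
      have h5 := Finset.card_le_card h1
      rw [h2, Finset.card_product, Finset.card_univ, Fintype.card_fin, mul_comm]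
      rw [Finset.card_product, Finset.card_univ, Fintype.card_fin, mul_comm] at h5
      exact h5.trans h4
  exact ⟨F, hF, fun x => (hmem _ _).1 (Finset.mem_product.1 (hF' x)).1⟩

/-- The Schröder–Bernstein bijection pairs points only through one of the two injections, hence
stays within `R`. -/
theorem exists_equiv_of_rel (R : P → Q → Prop) (a b : ℕ) (hfin : ∀ p, {q | R p q}.Finite)
    (hfin' : ∀ q, {p | R p q}.Finite)
    (h : ∀ A : Finset P, a * A.card ≤ b * {q | ∃ p ∈ A, R p q}.ncard)
    (h' : ∀ B : Finset Q, b * B.card ≤ a * {p | ∃ q ∈ B, R p q}.ncard) :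
    ∃ φ : P × Fin a ≃ Q × Fin b, ∀ x, R x.1 (φ x).1 := by
  obtain ⟨F, hF, hFR⟩ := exists_injective_of_rel R a b hfin h
  obtain ⟨F', hF', hFR'⟩ := exists_injective_of_rel (fun q p => R p q) b a hfin' h'
  obtain ⟨φ, hφ, hφR⟩ := Function.Embedding.schroeder_bernstein_of_rel hF hF'
    (fun x y => R x.1 y.1) hFR hFR'
  exact ⟨Equiv.ofBijective φ hφ, hφR⟩

end Matching

/-! ### Growth inequalities for successive thickenings. -/

section Growth

variable {a b : ℕ → ℝ} {κ C K : ℝ} {t N : ℕ}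

/-- In the application `b i` and `a i` count the `i`-th thickening of a set and its preimage. Let `δ
= b (t + 1) - b t`. If the claim fails, `hab` forces `N` later increments of `b` to be at least `δ /
(K * C)`, while their total is below `C * δ / κ`. -/
theorem le_of_quasi_linear_growth (ha : Monotone a) (hb : Monotone b) (hκ : 0 < κ)
    (hC : 0 < C) (hK : 0 ≤ K) (h : ∀ i, |κ * b i - a i| ≤ C * (b (i + 1) - b i))
    (hab : ∀ j, b (j + t) - b t ≤ K * (a (j + 2 * t) - a 0)) (hN : K * C ^ 2 < κ * N) :
    a 0 ≤ κ * b (2 * t + 1 + N) := by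
  by_contra! hlt
  set T := 2 * t + 1 + N with hT
  have h1 : ∀ i, κ * (b T - b i) < C * (b (i + 1) - b i) := fun i => by
    have := (abs_le.1 (h i)).1
    have := ha (Nat.zero_le i)
    linarith
  have h2 : ∀ j, j + 2 * t ≤ T → 1 ≤ j →
      b (t + 1) - b t ≤ K * C * (b (j + 2 * t + 1) - b (j + 2 * t)) := fun j hj hj1 => by
    have e1 := (abs_le.1 (h (j + 2 * t))).1
    have e2 := hb hj
    have e3 := hb (show t + 1 ≤ j + t by omega)
    have e4 : a (j + 2 * t) - a 0 ≤ C * (b (j + 2 * t + 1) - b (j + 2 * t)) := by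
      have := mul_le_mul_of_nonneg_left e2 hκ.le
      linarith
    have e5 := mul_le_mul_of_nonneg_left e4 hK
    have := hab j
    linarith
  have h3 : ∀ M, M ≤ N →
      M * (b (t + 1) - b t) ≤ K * C * (b (2 * t + 1 + M) - b (2 * t + 1)) := by
    intro M
    induction M with
    | zero => simp
    | succ M ih =>
      intro hM
      have e1 := ih (by omega)
      have e2 := h2 (M + 1) (by omega) (by omega)
      rw [show M + 1 + 2 * t + 1 = 2 * t + 1 + (M + 1) by ring,
        show M + 1 + 2 * t = 2 * t + 1 + M by ring] at e2
      push_cast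
      linarith
  have h4 := h3 N le_rfl
  have h5 := h1 t
  have h6 := hb (show t ≤ 2 * t + 1 by omega)
  have h7 := hb (show t ≤ T by omega)
  have hpos : 0 < b (t + 1) - b t := by
    have : 0 < C * (b (t + 1) - b t) :=
      lt_of_le_of_lt (mul_nonneg hκ.le (by linarith)) h5
    exact pos_of_mul_pos_right this hC.le
  have h8 : κ * (N * (b (t + 1) - b t)) ≤ K * C * (C * (b (t + 1) - b t)) := by
    calc κ * (N * (b (t + 1) - b t)) ≤ κ * (K * C * (b T - b (2 * t + 1))) :=
          mul_le_mul_of_nonneg_left h4 hκ.le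
      _ = K * C * (κ * (b T - b (2 * t + 1))) := by ring
      _ ≤ K * C * (C * (b (t + 1) - b t)) := by
          refine mul_le_mul_of_nonneg_left ?_ (by positivity)
          have := mul_le_mul_of_nonneg_left h6 hκ.le
          linarith
  have h9 := mul_lt_mul_of_pos_right hN hpos
  linarith

/-- Let `δ = b 1 - b 0`. If the claim fails, later increments of `b` up to the final index are at
least `κ * δ / C`, so by `hab` the growth of `a` is at least proportional to `N * δ`; yet this
growth is at most `C * δ`. -/
theorem le_of_quasi_linear_growth' (ha : Monotone a) (hb : Monotone b) (hκ : 0 < κ)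
    (hC : 0 < C) (hK : 0 ≤ K) (ht : 1 ≤ t) (h : ∀ i, |κ * b i - a i| ≤ C * (b (i + 1) - b i))
    (hab : ∀ j, b (j + t) - b t ≤ K * (a (j + 2 * t) - a 0)) (hN : K * C ^ 2 < κ * N) :
    κ * b 0 ≤ a (2 * t + 1 + N) := by
  by_contra! hlt
  set T := 2 * t + 1 + N with hT
  have h1 : ∀ i, i ≤ T → κ * (b i - b 0) < C * (b (i + 1) - b i) := fun i hi => by
    have := (abs_le.1 (h i)).2
    have := ha hi
    linarith
  have hpos : 0 < b 1 - b 0 := by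
    have := h1 0 (Nat.zero_le _)
    simp only [sub_self, mul_zero, zero_add] at this
    exact pos_of_mul_pos_right this hC.le
  have h2 : ∀ M, M ≤ N + 1 → M * (κ * (b 1 - b 0)) ≤ C * (b (M + t) - b t) := by
    intro M
    induction M with
    | zero => simp
    | succ M ih =>
      intro hM
      have e1 := ih (by omega)
      have e2 := h1 (M + t) (by omega)
      have e3 := mul_le_mul_of_nonneg_left (sub_le_sub_right (hb (show 1 ≤ M + t by omega)) (b 0))
        hκ.le
      rw [show M + 1 + t = M + t + 1 by ring]
      push_cast
      linarith
  have h3 := h2 (N + 1) le_rfl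
  have h4 := hab (N + 1)
  rw [show N + 1 + 2 * t = T by omega] at h4
  have h5 : a T - a 0 ≤ C * (b 1 - b 0) := by
    have := (abs_le.1 (h 0)).2
    rw [zero_add] at this
    linarith
  have h6 : (N + 1) * (κ * (b 1 - b 0)) ≤ C * (K * (C * (b 1 - b 0))) := by
    push_cast at h3
    exact h3.trans (mul_le_mul_of_nonneg_left
      (h4.trans (mul_le_mul_of_nonneg_left h5 hK)) hC.le)
  have h7 := mul_lt_mul_of_pos_right hN hpos
  have h8 := mul_pos hκ hpos
  linarith

end Growth

/-! ### From quasi-to-one maps to bijections at bounded distance. -/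

section QuasiToOne

variable {V W : Type*} {X : SimpleGraph V} {Y : SimpleGraph W} {f : V → W} {g : W → V} {L : ℕ}

/-- `g` maps the outer shell to the shell between the preimages with bounded multiplicity; `t ≥ L`
absorbs the distance from `y` to `f (g y)` on both sides. -/
theorem CoarseInverse.exists_ncard_thicken_diff_le (h : CoarseInverse X Y f g L)
    (hX : X.Connected) (hY : Y.Connected) (hXb : BoundedDegree X) (hYb : BoundedDegree Y) :
    ∃ K : ℕ, ∀ S : Set W, S.Finite → ∀ t, L ≤ t → ∀ j,
      ((thicken Y S (j + t)).ncard : ℝ) - (thicken Y S t).ncard ≤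
        K * ((f ⁻¹' thicken Y S (j + 2 * t)).ncard - (f ⁻¹' S).ncard) := by
  obtain ⟨K, hK⟩ := hYb.exists_encard_ball_le hY L
  obtain ⟨K', hK'⟩ := h.exists_ncard_preimage_le hX hY hXb
  refine ⟨K, fun S hS t ht j => ?_⟩
  have hT := fun i => hYb.finite_thicken hY hS i
  have h1 := (encard_le_mul_of_forall_exists (S := thicken Y S (j + t) \ thicken Y S t)
    (T := f ⁻¹' thicken Y S (j + 2 * t) \ f ⁻¹' S) (fun y x => Y.dist y (f x) ≤ L) (K := K)
    (fun y hy => ⟨g y, ⟨?_, fun hgy => ?_⟩, ?_⟩) (fun x _ => hK (f x))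
    ((hK' _ (hT _)).1.subset Set.sdiff_subset)).2
  · have h2 := Set.ncard_sdiff_add_ncard_of_subset
      (thicken_mono (G := Y) S (show t ≤ j + t by omega)) (hT _)
    have h3 := Set.ncard_sdiff_add_ncard_of_subset
      (Set.preimage_mono (f := f) (subset_thicken (G := Y) S (j + 2 * t))) (hK' _ (hT _)).1
    have h4 : ((thicken Y S (j + t)).ncard : ℝ) =
        (thicken Y S (j + t) \ thicken Y S t).ncard + (thicken Y S t).ncard := by
      exact_mod_cast h2.symm
    have h5 : ((f ⁻¹' thicken Y S (j + 2 * t)).ncard : ℝ) =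
        (f ⁻¹' thicken Y S (j + 2 * t) \ f ⁻¹' S).ncard + (f ⁻¹' S).ncard := by
      exact_mod_cast h3.symm
    rw [h4, h5, add_sub_cancel_right, add_sub_cancel_right]
    exact_mod_cast h1
  · have := mem_thicken_add hY hy.1 (h.left_right y)
    exact thicken_mono S (by omega) this
  · refine hy.2 ⟨f (g y), hgy, ?_⟩
    rw [SimpleGraph.dist_comm]
    exact (h.left_right y).trans ht
  · rw [SimpleGraph.dist_comm]
    exact h.left_right y

theorem QuasiToOne.exists_thicken {κ : ℝ} (hf : QuasiToOne Y κ f) (hκ : 0 < κ)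
    (h : CoarseInverse X Y f g L) (hX : X.Connected) (hY : Y.Connected)
    (hXb : BoundedDegree X) (hYb : BoundedDegree Y) :
    ∃ T : ℕ, ∀ S : Set W, S.Finite →
      ((f ⁻¹' S).ncard : ℝ) ≤ κ * (thicken Y S T).ncard ∧
        κ * S.ncard ≤ (f ⁻¹' thicken Y S T).ncard := by
  obtain ⟨K, hK⟩ := h.exists_ncard_thicken_diff_le hX hY hXb hYb
  obtain ⟨hfin, C, hC, hf⟩ := hf
  obtain ⟨N, hN⟩ := exists_nat_gt (K * C ^ 2 / κ)
  rw [div_lt_iff₀' hκ] at hN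
  -- The growth lemmas are used with `t = L + 1`, which is at least `L` and at least `1`.
  refine ⟨2 * (L + 1) + 1 + N, fun S hS => ?_⟩
  have hT := fun i => hYb.finite_thicken hY hS i
  have hpre : ∀ T : Set W, T.Finite → (f ⁻¹' T).Finite := fun T hT => by
    lift T to Finset W using hT
    exact hfin T
  have ha : Monotone fun i => ((f ⁻¹' thicken Y S i).ncard : ℝ) := fun i j hij =>
    Nat.cast_le.2 (Set.ncard_le_ncard (Set.preimage_mono (thicken_mono S hij)) (hpre _ (hT j)))
  have hb : Monotone fun i => ((thicken Y S i).ncard : ℝ) := fun i j hij =>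
    Nat.cast_le.2 (Set.ncard_le_ncard (thicken_mono S hij) (hT j))
  have hquasi : ∀ i, |κ * ((thicken Y S i).ncard : ℝ) - ((f ⁻¹' thicken Y S i).ncard : ℝ)| ≤
      C * (((thicken Y S (i + 1)).ncard : ℝ) - ((thicken Y S i).ncard : ℝ)) := by
    intro i
    obtain ⟨F, hF⟩ := (hT i).exists_finset_coe
    have h1 := hf F
    rw [← Set.ncard_coe_finset F, hF] at h1
    refine h1.trans (mul_le_mul_of_nonneg_left ?_ hC.le)
    have h2 := Set.ncard_le_ncard (boundary_thicken_subset hY S i)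
      ((hT (i + 1)).subset Set.sdiff_subset)
    have h3 := Set.ncard_sdiff_add_ncard_of_subset
      (thicken_mono (G := Y) S (Nat.le_add_right i 1)) (hT _)
    rw [le_sub_iff_add_le]
    exact_mod_cast (by omega : _ ≤ _)
  have hab : ∀ j, ((thicken Y S (j + (L + 1))).ncard : ℝ) - ((thicken Y S (L + 1)).ncard : ℝ) ≤
      K * (((f ⁻¹' thicken Y S (j + 2 * (L + 1))).ncard : ℝ) -
        ((f ⁻¹' thicken Y S 0).ncard : ℝ)) := fun j => by
    rw [thicken_zero hY]
    exact hK S hS (L + 1) (Nat.le_succ L) j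
  have h1 := le_of_quasi_linear_growth ha hb hκ hC (Nat.cast_nonneg K) hquasi hab hN
  have h2 := le_of_quasi_linear_growth' ha hb hκ hC (Nat.cast_nonneg K) (Nat.le_add_left 1 L)
    hquasi hab hN
  simp only [thicken_zero hY] at h1 h2
  exact ⟨h1, h2⟩

/-- Quasi-`(s/r)`-to-one quasi-isometries are close to bijections `X × r ≃ Y × s`. -/
theorem QuasiToOne.exists_equiv {r s : ℕ} (hr : 1 ≤ r) (hs : 1 ≤ s)
    (hf : QuasiToOne Y ((s : ℝ) / r) f) (h : CoarseInverse X Y f g L) (hX : X.Connected)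
    (hY : Y.Connected) (hXb : BoundedDegree X) (hYb : BoundedDegree Y) :
    ∃ T : ℕ, ∃ φ : V × Fin r ≃ W × Fin s, ∀ x, Y.dist (f x.1) (φ x).1 ≤ T := by
  have hr0 : (0 : ℝ) < r := by exact_mod_cast hr
  have hs0 : (0 : ℝ) < s := by exact_mod_cast hs
  obtain ⟨T, hT⟩ := hf.exists_thicken (div_pos hs0 hr0) h hX hY hXb hYb
  obtain ⟨K, hK⟩ := h.exists_ncard_preimage_le hX hY hXb
  refine ⟨T, exists_equiv_of_rel (fun x y => Y.dist (f x) y ≤ T) r s (fun x => ?_) (fun y => ?_)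
    (fun A => ?_) (fun B => ?_)⟩
  · refine (hYb.finite_thicken hY (Set.finite_singleton (f x)) T).subset fun y hy => ?_
    exact ⟨f x, rfl, by rw [SimpleGraph.dist_comm]; exact hy⟩
  · refine (hK _ (hYb.finite_thicken hY (Set.finite_singleton y) T)).1.subset fun x hx => ?_
    exact ⟨y, rfl, hx⟩
  · have h1 := (hT _ (A.finite_toSet.image f)).1
    have h2 : {y | ∃ x ∈ A, Y.dist (f x) y ≤ T} = thicken Y (f '' A) T := by
      ext y
      simp [thicken, SimpleGraph.dist_comm (u := y)]
    have h3 := Set.ncard_le_ncard (Set.subset_preimage_image f (A : Set V))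
      (hK _ (A.finite_toSet.image f)).1
    rw [Set.ncard_coe_finset] at h3
    rw [h2]
    rw [div_mul_eq_mul_div, le_div_iff₀ hr0] at h1
    have h4 : (f ⁻¹' (f '' A)).ncard * r ≤ s * (thicken Y (f '' A) T).ncard := by
      exact_mod_cast h1
    exact (by rw [mul_comm]; exact Nat.mul_le_mul_right _ h3 :
      r * A.card ≤ (f ⁻¹' (f '' A)).ncard * r).trans h4
  · have h1 := (hT _ B.finite_toSet).2
    have h2 : {x | ∃ y ∈ B, Y.dist (f x) y ≤ T} = f ⁻¹' thicken Y B T := rfl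
    rw [h2]
    rw [Set.ncard_coe_finset, div_mul_eq_mul_div, div_le_iff₀ hr0, mul_comm _ (r : ℝ)] at h1
    exact_mod_cast h1

end QuasiToOne

/-! ### Isoperimetry in non-amenable graphs. -/

section NonAmenable

variable {V W : Type*} {X : SimpleGraph V} {Y : SimpleGraph W} {f : V → W} {g : W → V} {L : ℕ}

/-- Sets violating the inequality for larger and larger constants would form a Følner sequence. -/
theorem exists_card_le_of_not_amenable (h : ¬ Amenable X) :
    ∃ E : ℕ, ∀ A : Finset V, A.card ≤ E * (boundary X (A : Set V)).ncard := by
  by_contra! hE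
  choose A hA using hE
  refine h ⟨fun i => A (i + 1), fun i => Finset.card_pos.1 (Nat.zero_lt_of_lt (hA _)), ?_⟩
  refine squeeze_zero (fun i => by positivity) (fun i => ?_)
    (tendsto_one_div_add_atTop_nhds_zero_nat (𝕜 := ℝ))
  have h1 : (0 : ℝ) < (A (i + 1)).card := by exact_mod_cast Nat.zero_lt_of_lt (hA (i + 1))
  have h2 : ((i : ℝ) + 1) * (boundary X (A (i + 1) : Set V)).ncard ≤ (A (i + 1)).card := by
    exact_mod_cast (hA (i + 1)).le
  rw [div_le_div_iff₀ h1 (by positivity)]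
  linarith

theorem CoarseInverse.exists_card_le_of_not_amenable (h : CoarseInverse X Y f g L)
    (hX : X.Connected) (hY : Y.Connected) (hXb : BoundedDegree X) (hYb : BoundedDegree Y)
    (hna : ¬ Amenable X) :
    ∃ E : ℕ, ∀ B : Finset W, B.card ≤ E * (boundary Y (B : Set W)).ncard := by
  obtain ⟨E, hE⟩ := LampRigid.exists_card_le_of_not_amenable hna
  obtain ⟨K, hK⟩ := hYb.exists_encard_ball_le hY L
  obtain ⟨K₁, hK₁⟩ := h.exists_ncard_preimage_le hX hY hXb
  obtain ⟨K₂, hK₂⟩ := hYb.exists_ncard_thicken_diff_le hY (L + 2 * L)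
  refine ⟨K * (E * (K₁ * K₂)), fun B => ?_⟩
  have hB := B.finite_toSet
  have hfin := (hK₁ _ (hYb.finite_thicken hY hB L)).1
  have hfin' : (thicken Y (B : Set W) (L + 2 * L) \ B).Finite :=
    (hYb.finite_thicken hY hB _).subset Set.sdiff_subset
  have h1 := (encard_le_mul_of_forall_exists (S := (B : Set W))
    (T := f ⁻¹' thicken Y (B : Set W) L) (fun y x => Y.dist y (f x) ≤ L) (K := K)
    (fun y hy => ⟨g y, ⟨y, hy, h.left_right y⟩, by
      rw [SimpleGraph.dist_comm]; exact h.left_right y⟩) (fun x _ => hK (f x)) hfin).2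
  obtain ⟨A, hA⟩ := hfin.exists_finset_coe
  have h2 := hE A
  rw [← Set.ncard_coe_finset A, hA] at h2
  -- An edge of `X` is moved by `f` to points at distance at most `2 * L`.
  have h3 : boundary X (f ⁻¹' thicken Y (B : Set W) L) ⊆
      f ⁻¹' (thicken Y (B : Set W) (L + 2 * L) \ B) := by
    rintro v ⟨hv, a, ha, hav⟩
    refine ⟨mem_thicken_add hY ha ?_, fun hvB => hv (subset_thicken _ _ hvB)⟩
    have := h.lip_left v a
    rw [SimpleGraph.dist_eq_one_iff_adj.2 hav.symm] at this
    omega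
  have h4 := (Set.ncard_le_ncard h3 (hK₁ _ hfin').1).trans
    ((hK₁ _ hfin').2.trans (Nat.mul_le_mul_left _ (hK₂ _ hB)))
  rw [Set.ncard_coe_finset] at h1
  calc B.card ≤ K * (E * (K₁ * (K₂ * (boundary Y (B : Set W)).ncard))) :=
        h1.trans (Nat.mul_le_mul_left _ (h2.trans (Nat.mul_le_mul_left _ h4)))
    _ = _ := by ring

/-- Quasi-isometries between non-amenable graphs are quasi-`κ`-to-one for all `κ`. -/
theorem CoarseInverse.quasiToOne_of_not_amenable (h : CoarseInverse X Y f g L)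
    (hX : X.Connected) (hY : Y.Connected) (hXb : BoundedDegree X) (hYb : BoundedDegree Y)
    (hna : ¬ Amenable X) {κ : ℝ} (hκ : 0 ≤ κ) : QuasiToOne Y κ f := by
  obtain ⟨E, hE⟩ := h.exists_card_le_of_not_amenable hX hY hXb hYb hna
  obtain ⟨K, hK⟩ := h.exists_ncard_preimage_le hX hY hXb
  refine ⟨fun A => (hK _ A.finite_toSet).1, (κ + K) * E + 1, by positivity, fun A => ?_⟩
  have h1 : (A.card : ℝ) ≤ E * (boundary Y (A : Set W)).ncard := by exact_mod_cast hE A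
  have h2 : ((f ⁻¹' (A : Set W)).ncard : ℝ) ≤ K * A.card := by
    have := (hK _ A.finite_toSet).2
    rw [Set.ncard_coe_finset] at this
    exact_mod_cast this
  have h3 : (0 : ℝ) ≤ (f ⁻¹' (A : Set W)).ncard := by positivity
  have h4 := mul_le_mul_of_nonneg_left h1 hκ
  have h5 := mul_le_mul_of_nonneg_left h1 (Nat.cast_nonneg (α := ℝ) K)
  have h6 : (0 : ℝ) ≤ (boundary Y (A : Set W)).ncard := by positivity
  have h7 : 0 ≤ κ * A.card := by positivity
  have h8 : (0 : ℝ) ≤ K * A.card := by positivity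
  rw [abs_le]
  constructor <;> linarith

end NonAmenable

theorem dist_le_mul_of_forall_adj {U U' : Type*} {G : SimpleGraph U} {H : SimpleGraph U'}
    (hG : G.Connected) (hH : H.Connected) {F : U → U'} {k : ℕ}
    (h : ∀ u v, G.Adj u v → H.dist (F u) (F v) ≤ k) (u v : U) :
    H.dist (F u) (F v) ≤ k * G.dist u v := by
  obtain ⟨p, hp⟩ := hG.exists_walk_length_eq_dist u v
  rw [← hp]
  clear hp
  induction p with
  | nil => simp
  | @cons u u' v huv p ih =>
    have h1 := h u u' huv
    have h2 := hH.dist_triangle (u := F u) (v := F u') (w := F v)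
    rw [SimpleGraph.Walk.length_cons, mul_add, mul_one]
    omega

/-! ### Quasi-isometries built from local bijections. -/

section Aptolic

variable {V W : Type*} {X : SimpleGraph V} {Y : SimpleGraph W} {n m : ℕ}
  {α : (V →₀ ZMod n) → (W →₀ ZMod m)} {f : V → W} {g : W → V} {C : ℕ}

theorem LocalOver.exists_dist_le_mul (hα : LocalOver Y α f C) (h : CoarseInverse X Y f g C)
    (hX : X.Connected) (hY : Y.Connected) (hYb : BoundedDegree Y) :
    ∃ k : ℕ, ∀ a b : (V →₀ ZMod n) × V,
      (lamplighter m Y).dist (α a.1, f a.2) (α b.1, f b.2) ≤ k * (lamplighter n X).dist a b := by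
  obtain ⟨E, hE⟩ := exists_dist_lamplighter_le hY hYb m C
  refine ⟨E + 2 * C, dist_le_mul_of_forall_adj (F := fun a => (α a.1, f a.2))
    (lamplighter_connected hX) (lamplighter_connected hY) fun a b hab => ?_⟩
  rcases lamplighter_adj_iff.1 hab with ⟨h1, h2⟩ | ⟨h1, -, h3⟩
  · have h4 := h.lip_left a.2 b.2
    rw [SimpleGraph.dist_eq_one_iff_adj.2 h2] at h4
    simp only [h1, dist_leaf hY]
    omega
  · have h4 := hE (α a.1) (α b.1) (f a.2) (f b.2) (hα a.1 b.1 a.2 h3)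
    rw [← h1, SimpleGraph.dist_self] at h4
    simp only [← h1]
    omega

/-- A local bijection between colourings over a quasi-isometry yields a quasi-isometry between
the lamplighter graphs. -/
theorem LocalOver.quasiIsometric {α : (V →₀ ZMod n) ≃ (W →₀ ZMod m)} (hα : LocalOver Y α f C)
    (hα' : LocalOver X α.symm g C) (h : CoarseInverse X Y f g C) (hX : X.Connected)
    (hY : Y.Connected) (hXb : BoundedDegree X) (hYb : BoundedDegree Y) :
    QuasiIsometric (lamplighter n X) (lamplighter m Y) := by
  obtain ⟨k, hk⟩ := hα.exists_dist_le_mul h hX hY hYb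
  obtain ⟨k', hk'⟩ := hα'.exists_dist_le_mul h.symm hY hX hXb
  refine ⟨fun a => (α a.1, f a.2), CoarseInverse.isQuasiIsometry
    (g := fun b => (α.symm b.1, g b.2)) (L := k + k' + C) ⟨fun a b => ?_, fun a b => ?_,
      fun a => ?_, fun b => ?_⟩ (lamplighter_connected hX)⟩
  · refine (hk a b).trans ((Nat.mul_le_mul_right _ ?_).trans (Nat.le_add_right _ _))
    omega
  · refine (hk' a b).trans ((Nat.mul_le_mul_right _ ?_).trans (Nat.le_add_right _ _))
    omega
  · have h1 := dist_leaf hX a.1 (g (f a.2)) a.2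
    have h2 := h.right_left a.2
    simp only [Equiv.symm_apply_apply, h1]
    omega
  · have h1 := dist_leaf hY b.1 (f (g b.2)) b.2
    have h2 := h.left_right b.2
    simp only [Equiv.apply_symm_apply, h1]
    omega

end Aptolic

/-! ### Moving elementary lamps along bijections. -/

section Transport

variable {ι P Q N M : Type*} [Finite ι] [Zero N] [Zero M] {a b : ι → ℕ} {K : ι → Type*}

/-- Transport of finitely supported colourings, whose colours are products of elementary
colours, along bijections between the sets of elementary lamps. -/
noncomputable def transportColoring (ψ : ∀ j, Q × Fin (b j) ≃ P × Fin (a j)) (o : ∀ j, K j)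
    (eN : N ≃ ∀ j, Fin (a j) → K j) (eM : M ≃ ∀ j, Fin (b j) → K j)
    (hN : eN 0 = fun j _ => o j) (hM : eM 0 = fun j _ => o j) (c : P →₀ N) : Q →₀ M :=
  Finsupp.ofSupportFinite
    (fun y => eM.symm fun j i => eN (c (ψ j (y, i)).1) j (ψ j (y, i)).2) <| by
      have hfin : (⋃ j, Prod.fst '' (ψ j ⁻¹' ((c.support : Set P) ×ˢ Set.univ))).Finite :=
        Set.finite_iUnion fun j =>
          (((c.support.finite_toSet.prod Set.finite_univ).preimage
            (ψ j).injective.injOn).image _)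
      refine hfin.subset fun y hy => ?_
      by_contra hy'
      refine hy ?_
      rw [Equiv.symm_apply_eq, hM]
      funext j i
      have hc : c (ψ j (y, i)).1 = 0 := by
        by_contra hne
        exact hy' (Set.mem_iUnion.2 ⟨j, (y, i),
          ⟨Finset.mem_coe.2 (Finsupp.mem_support_iff.2 hne), Set.mem_univ _⟩, rfl⟩)
      rw [hc, hN]

theorem transportColoring_apply (ψ : ∀ j, Q × Fin (b j) ≃ P × Fin (a j)) (o : ∀ j, K j)
    (eN : N ≃ ∀ j, Fin (a j) → K j) (eM : M ≃ ∀ j, Fin (b j) → K j)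
    (hN : eN 0 = fun j _ => o j) (hM : eM 0 = fun j _ => o j) (c : P →₀ N) (y : Q) :
    transportColoring ψ o eN eM hN hM c y =
      eM.symm fun j i => eN (c (ψ j (y, i)).1) j (ψ j (y, i)).2 := rfl

theorem transportColoring_symm (ψ : ∀ j, Q × Fin (b j) ≃ P × Fin (a j)) (o : ∀ j, K j)
    (eN : N ≃ ∀ j, Fin (a j) → K j) (eM : M ≃ ∀ j, Fin (b j) → K j)
    (hN : eN 0 = fun j _ => o j) (hM : eM 0 = fun j _ => o j) (c : P →₀ N) :
    transportColoring (fun j => (ψ j).symm) o eM eN hM hN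
      (transportColoring ψ o eN eM hN hM c) = c := by
  ext x
  rw [transportColoring_apply, Equiv.symm_apply_eq]
  funext j i
  rw [transportColoring_apply, Equiv.apply_symm_apply]
  simp

theorem exists_of_transportColoring_ne (ψ : ∀ j, Q × Fin (b j) ≃ P × Fin (a j)) (o : ∀ j, K j)
    (eN : N ≃ ∀ j, Fin (a j) → K j) (eM : M ≃ ∀ j, Fin (b j) → K j)
    (hN : eN 0 = fun j _ => o j) (hM : eM 0 = fun j _ => o j) {c c' : P →₀ N} {y : Q}
    (h : transportColoring ψ o eN eM hN hM c y ≠ transportColoring ψ o eN eM hN hM c' y) :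
    ∃ j i, c (ψ j (y, i)).1 ≠ c' (ψ j (y, i)).1 := by
  by_contra! hall
  refine h ?_
  rw [transportColoring_apply, transportColoring_apply]
  congr 1
  funext j i
  rw [hall j i]

/-- Fixing the image of `0` is what keeps transported colourings finitely supported. -/
theorem exists_equiv_map_zero {N' : Type*} [Finite N] (h : Nat.card N = Nat.card N') (z : N')
    [Finite N'] : ∃ e : N ≃ N', e 0 = z := by
  classical
  obtain ⟨e⟩ := Finite.card_eq.1 h
  exact ⟨e.trans (Equiv.swap (e 0) z), by simp⟩

end Transport

/-! ### Lamplighter graphs with matching elementary lamps. -/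

section Construction

variable {V W : Type*} {X : SimpleGraph V} {Y : SimpleGraph W} {n m : ℕ} {f : V → W} {g : W → V}
  {L : ℕ}

theorem exists_equiv_zmod_pi {ι : Type*} [Fintype ι] (k a : ι → ℕ) (hk : ∀ j, 0 < k j)
    (hn : n = ∏ j, k j ^ a j) :
    ∃ e : ZMod n ≃ ∀ j, Fin (a j) → Fin (k j), e 0 = fun j _ => ⟨0, hk j⟩ := by
  have hn0 : n ≠ 0 := by
    rw [hn]
    exact Finset.prod_ne_zero_iff.2 fun j _ => pow_ne_zero _ (hk j).ne'
  have : NeZero n := ⟨hn0⟩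
  refine exists_equiv_map_zero ?_ _
  rw [Nat.card_zmod, Nat.card_pi, hn]
  exact Finset.prod_congr rfl fun j _ => by rw [Nat.card_fun]; simp

/-- Lamplighter graphs are quasi-isometric if their lamps decompose into elementary lamps that
correspond to each other over a quasi-isometry of the base graphs. -/
theorem quasiIsometric_of_equiv {ι : Type*} [Fintype ι] (k a b : ι → ℕ) (hk : ∀ j, 0 < k j)
    (hn : n = ∏ j, k j ^ a j) (hm : m = ∏ j, k j ^ b j) (h : CoarseInverse X Y f g L)
    (hX : X.Connected) (hY : Y.Connected) (hXb : BoundedDegree X) (hYb : BoundedDegree Y)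
    (hφ : ∀ j, ∃ T : ℕ, ∃ φ : V × Fin (a j) ≃ W × Fin (b j), ∀ x, Y.dist (f x.1) (φ x).1 ≤ T) :
    QuasiIsometric (lamplighter n X) (lamplighter m Y) := by
  choose T φ hφ using hφ
  obtain ⟨eN, hN⟩ := exists_equiv_zmod_pi k a hk hn
  obtain ⟨eM, hM⟩ := exists_equiv_zmod_pi k b hk hm
  set S := ∑ j, T j
  have hTS : ∀ j, T j ≤ S := fun j => Finset.single_le_sum (fun _ _ => Nat.zero_le _)
    (Finset.mem_univ j)
  let o : ∀ j, Fin (k j) := fun j => ⟨0, hk j⟩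
  let α : (V →₀ ZMod n) ≃ (W →₀ ZMod m) :=
    ⟨transportColoring (fun j => (φ j).symm) o eN eM hN hM,
      transportColoring φ o eM eN hM hN,
      fun c => transportColoring_symm (fun j => (φ j).symm) o eN eM hN hM c,
      fun d => transportColoring_symm φ o eM eN hM hN d⟩
  -- `S` suffices over `f`. Over `g`, a point `y` within `S` of `f x` has `g y` within `L * S + L`
  -- of `g (f x)`, which is within `L` of `x`.
  have h1 : LocalOver Y α f (S + (L * S + L + L)) := by
    intro c c' x hc y hy
    obtain ⟨j, i, hji⟩ := exists_of_transportColoring_ne (fun j => (φ j).symm) o eN eM hN hM hy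
    have hx : ((φ j).symm (y, i)).1 = x := by
      by_contra hne
      exact hji (hc _ hne)
    have h2 := hφ j ((φ j).symm (y, i))
    rw [Equiv.apply_symm_apply, hx] at h2
    have := hTS j
    simp only at h2
    omega
  have h2 : LocalOver X α.symm g (S + (L * S + L + L)) := by
    intro d d' y hd x hx
    obtain ⟨j, i, hji⟩ := exists_of_transportColoring_ne φ o eM eN hM hN hx
    have hy : ((φ j) (x, i)).1 = y := by
      by_contra hne
      exact hji (hd _ hne)
    have h2 := hφ j (x, i)
    rw [hy, SimpleGraph.dist_comm] at h2
    have h3 := h.lip_right y (f x)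
    have h4 := h.right_left x
    have h5 := hX.dist_triangle (u := g y) (v := g (f x)) (w := x)
    have h6 := Nat.mul_le_mul_left L (h2.trans (hTS j))
    simp only at h2 h6
    omega
  exact h1.quasiIsometric h2 (h.mono (by omega)) hX hY hXb hYb

end Construction

end LampRigid

theorem mainTheorem1 {V W : Type*} (n m : ℕ) (hn : 2 ≤ n) (hm : 2 ≤ m)
    (X : SimpleGraph V) (Y : SimpleGraph W)
    (hX : LampRigid.BoundedDegree X) (hY : LampRigid.BoundedDegree Y)
    (hX1 : LampRigid.CoarselyOneConnected X) (hY1 : LampRigid.CoarselyOneConnected Y)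
    (hXe : LampRigid.UniformlyOneEnded X) (hYe : LampRigid.UniformlyOneEnded Y) :
    (LampRigid.Amenable X →
      (LampRigid.QuasiIsometric (LampRigid.lamplighter n X) (LampRigid.lamplighter m Y) ↔
        ∃ k r s : ℕ, 1 ≤ k ∧ 1 ≤ r ∧ 1 ≤ s ∧ n = k ^ r ∧ m = k ^ s ∧
          ∃ f : V → W, LampRigid.IsQuasiIsometry X Y f ∧
            LampRigid.QuasiToOne Y ((s : ℝ) / (r : ℝ)) f)) ∧
    (¬ LampRigid.Amenable X →
      (LampRigid.QuasiIsometric (LampRigid.lamplighter n X) (LampRigid.lamplighter m Y) ↔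
        LampRigid.QuasiIsometric X Y ∧ ∀ p : ℕ, p.Prime → (p ∣ n ↔ p ∣ m))) := by
  have hn0 : n ≠ 0 := by omega
  have hm0 : m ≠ 0 := by omega
  refine ⟨fun ham => ⟨fun hq => ?_, ?_⟩, fun hna => ⟨fun hq => ?_, ?_⟩⟩
  · obtain ⟨α, f, g, C, h, hα, hα'⟩ := hq.exists_localOver hn hm hX hY hX1 hY1 hXe hYe
    obtain ⟨p, k, r, s, hk, hr, hs, hnk, hmk, hp, hpr⟩ :=
      LampRigid.exists_eq_pow_of_factorization_mul_comm hn hm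
        (hα.factorization_mul_comm hα' h hn0 hm0 hX1.1 hY1.1 hX hY ham)
    refine ⟨k, r, s, hk, hr, hs, hnk, hmk, f, h.isQuasiIsometry hX1.1, ?_⟩
    rw [← hpr]
    exact hα.quasiToOne hα' h hn0 hm0 hX1.1 hY1.1 hX hY hp
  · rintro ⟨k, r, s, hk, hr, hs, hnk, hmk, f, hf, hfκ⟩
    obtain ⟨g, L, h⟩ := hf.exists_coarseInverse hY1.1
    -- A single kind of elementary lamp, with `k` colours.
    exact LampRigid.quasiIsometric_of_equiv (ι := Unit) (fun _ => k) (fun _ => r) (fun _ => s)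
      (fun _ => hk) (by simpa using hnk) (by simpa using hmk) h hX1.1 hY1.1 hX hY
      fun _ => hfκ.exists_equiv hr hs h hX1.1 hY1.1 hX hY
  · obtain ⟨α, f, g, C, h, hα, hα'⟩ := hq.exists_localOver hn hm hX hY hX1 hY1 hXe hYe
    exact ⟨⟨f, h.isQuasiIsometry hX1.1⟩, fun p hp =>
      ⟨hα.dvd_of_prime_dvd hX1.1 hY1.1 hY hp, hα'.dvd_of_prime_dvd hY1.1 hX1.1 hX hp⟩⟩
  · rintro ⟨⟨f, hf⟩, hp⟩
    obtain ⟨g, L, h⟩ := hf.exists_coarseInverse hY1.1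
    have hpf : m.primeFactors = n.primeFactors := by
      ext p
      simp only [Nat.mem_primeFactors]
      exact ⟨fun ⟨h1, h2, _⟩ => ⟨h1, (hp p h1).2 h2, hn0⟩,
        fun ⟨h1, h2, _⟩ => ⟨h1, (hp p h1).1 h2, hm0⟩⟩
    have hprod : ∀ l : ℕ, l ≠ 0 → l.primeFactors = n.primeFactors →
        l = ∏ j : n.primeFactors, (j : ℕ) ^ l.factorization j := by
      intro l hl hlf
      rw [Finset.prod_coe_sort n.primeFactors fun p => p ^ l.factorization p, ← hlf]
      exact (Nat.prod_factorization_pow_eq_self hl).symm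
    have hpos : ∀ (l : ℕ), l ≠ 0 → l.primeFactors = n.primeFactors →
        ∀ j : n.primeFactors, 1 ≤ l.factorization j := by
      intro l hl hlf j
      have h1 := Nat.mem_primeFactors.1 (show (j : ℕ) ∈ l.primeFactors by rw [hlf]; exact j.2)
      exact h1.1.factorization_pos_of_dvd hl h1.2.1
    -- One kind of elementary lamp for each prime, each with its own ratio of multiplicities over
    -- the same `f`.
    refine LampRigid.quasiIsometric_of_equiv (ι := n.primeFactors) (fun j => (j : ℕ))
      (fun j => n.factorization j) (fun j => m.factorization j)
      (fun j => (Nat.prime_of_mem_primeFactors j.2).pos) (hprod n hn0 rfl) (hprod m hm0 hpf)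
      h hX1.1 hY1.1 hX hY fun j => ?_
    exact LampRigid.QuasiToOne.exists_equiv (hpos n hn0 rfl j) (hpos m hm0 hpf j)
      (h.quasiToOne_of_not_amenable hX1.1 hY1.1 hX hY hna (by positivity))
      h hX1.1 hY1.1 hX hY
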